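/- Let $H\in[-\infty,1/2]$ and let $T=\bigcup_{n\ge 0}\{0,1\}^n$ be the set of finite binary words. Let $(\epsilon(w))_{w\in T}$ be independent, identically distributed random variables taking the values $1$ and $-1$ with respective probabilities $(1+2^{H-1})/2$ and $(1-2^{H-1})/2$, where $2^{-\infty}=0$. For $n\ge 1$ and $w=w_1\cdots w_n\in\{0,1\}^n$ put $\boldsymbol{\epsilon}(w)=\prod_{k=1}^n\epsilon(w_1\cdots w_k)$. For $0\le k<2^n$ let $\xi^{(n)}_k=\boldsymbol{\epsilon}(w)$, where $w$ is the unique word in $\{0,1\}^n$ with $\sum_{i=1}^n w_i2^{-i}=k2^{-n}$, and let $S^{(n)}_r=\sum_{k=0}^{r-1}\xi^{(n)}_k$ for $0\le r\le 2^n$. For $t\in[0,1]$ let $$L_n(t)=S^{(n)}_{[2^nt]}+(2^nt-[2^nt])\,\xi^{(n)}_{[2^nt]}$$ (the last term being $0$ at $t=1$). For $H>-\infty$ let $B_n(t)=2^{-nH}L_n(t)$, and let $\sigma=\sqrt{1+(2^{2-2H}-2)^{-1}}$ if $H<1/2$ and $\sigma=1/\sqrt2$ if $H=1/2$. Define $$X_n=\frac{B_n}{\sigma\,2^{n(1/2-H)}}\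 \text{ if } -\infty<H<1/2,\qquad X_n=\frac{B_n}{\sigma\sqrt n}\ \text{ if } H=1/2,\qquad X_n=2^{-n/2}L_n\ \text{ if } H=-\infty.$$ Then, as $n\to\infty$, the sequence of continuous processes $(X_n)_{n\ge1}$ converges in law in $\mathcal{C}([0,1])$, endowed with the uniform norm, to the restriction to $[0,1]$ of the standard Brownian motion. -/

import Mathlib

open MeasureTheory ProbabilityTheory Filter Topology

noncomputable section

namespace SignedCascade

/-- The space `C([0,1])`, whose topology is that of the uniform norm, carries its Borel
`σ`-algebra. -/
instance instMeasurableSpacePaths : MeasurableSpace C(unitInterval, ℝ) := borel _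

instance instBorelSpacePaths : BorelSpace C(unitInterval, ℝ) := ⟨rfl⟩

/-! ### The random signs -/

/-- `2 ^ (H - 1)`, the mean of a sign `ε`, for `H ∈ [-∞, 1/2]`; it is `0` at `H = -∞`.
(The value at `H = +∞` is irrelevant.) -/
def signMean (H : EReal) : ℝ :=
  if H = ⊥ then 0 else (2 : ℝ) ^ (H.toReal - 1)

/-- The law of a sign `ε`: it takes the values `1` and `-1` with respective probabilities
`(1 + 2 ^ (H - 1)) / 2` and `(1 - 2 ^ (H - 1)) / 2`. -/
def signLaw (H : EReal) : Measure ℝ :=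
  ENNReal.ofReal ((1 + signMean H) / 2) • Measure.dirac 1 +
    ENNReal.ofReal ((1 - signMean H) / 2) • Measure.dirac (-1)

/-! ### Words and dyadic points

A node `w = w₁ ⋯ wₙ` of the binary tree is the list `[w₁, …, wₙ]` of its digits
(`false` is the digit `0` and `true` the digit `1`); the empty list is the root. -/

/-- `t_w = ∑ wᵢ 2⁻ⁱ`, the left end point of the dyadic interval encoded by `w`. -/
def dyadicPoint (w : List Bool) : ℝ :=
  ∑ i : Fin w.length, (if w.get i then 1 else 0) * (2 : ℝ)⁻¹ ^ ((i : ℕ) + 1)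

/-- The word of length `n` made of the `n` lowest binary digits of `k`, the most significant one
coming first. For `k < 2 ^ n` it is the word `w` of length `n` with `t_w = k / 2 ^ n`
(see `dyadicPoint_dyadicWord`). -/
def dyadicWord : ℕ → ℕ → List Bool
  | 0, _ => []
  | n + 1, k => k.testBit n :: dyadicWord n k

theorem length_dyadicWord (n k : ℕ) : (dyadicWord n k).length = n := by
  induction n with
  | zero => rfl
  | succ n ih => simp [dyadicWord, ih]

theorem dyadicPoint_cons (b : Bool) (w : List Bool) :
    dyadicPoint (b :: w) = ((if b then 1 else 0) + dyadicPoint w) / 2 := by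
  have h0 : dyadicPoint (b :: w) = (if b then 1 else 0) * (2 : ℝ)⁻¹ ^ (0 + 1) +
      ∑ i : Fin w.length, (if w.get i then 1 else 0) * (2 : ℝ)⁻¹ ^ ((i : ℕ) + 1 + 1) :=
    Fin.sum_univ_succ (n := w.length) _
  rw [h0, add_div, dyadicPoint, Finset.sum_div]
  congr 1
  · split_ifs <;> norm_num
  · refine Finset.sum_congr rfl fun i _ => ?_
    rw [pow_succ _ ((i : ℕ) + 1)]
    ring

theorem dyadicPoint_dyadicWord_mod (n k : ℕ) :
    dyadicPoint (dyadicWord n k) = ((k % 2 ^ n : ℕ) : ℝ) / 2 ^ n := by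
  induction n with
  | zero =>
    have h0 : dyadicPoint [] = 0 := Finset.sum_eq_zero fun i _ => i.elim0
    simp [dyadicWord, h0, Nat.mod_one]
  | succ n ih =>
    rw [dyadicWord, dyadicPoint_cons, ih, Nat.mod_pow_succ, Nat.testBit_eq_decide_div_mod_eq]
    rcases Nat.mod_two_eq_zero_or_one (k / 2 ^ n) with h | h <;> simp [h] <;> field_simp <;> ring

/-- For `k < 2 ^ n`, `dyadicWord n k` is the word `w` of length `n` with `t_w = k 2⁻ⁿ`. -/
theorem dyadicPoint_dyadicWord {n k : ℕ} (hk : k < 2 ^ n) :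
    dyadicPoint (dyadicWord n k) = (k : ℝ) / 2 ^ n := by
  rw [dyadicPoint_dyadicWord_mod, Nat.mod_eq_of_lt hk]

/-! ### The correlated random walk

Here `e : List Bool → ℝ` is a realization `(ε(w))_w` of the signs. -/

/-- The product `ε(w₁) ε(w₁ w₂) ⋯ ε(w₁ ⋯ wₙ)` along the word `w = w₁ ⋯ wₙ`. -/
def signProd (e : List Bool → ℝ) (w : List Bool) : ℝ :=
  ∏ k ∈ Finset.range w.length, e (w.take (k + 1))

/-- The step `ξ_k^{(n)}`, for `0 ≤ k < 2 ^ n`. -/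
def step (e : List Bool → ℝ) (n k : ℕ) : ℝ :=
  signProd e (dyadicWord n k)

/-- The random walk `S_r^{(n)} = ∑_{k < r} ξ_k^{(n)}`. -/
def walk (e : List Bool → ℝ) (n r : ℕ) : ℝ :=
  ∑ k ∈ Finset.range r, step e n k

/-- The linear interpolation `S_{[2ⁿ t]}^{(n)} + (2ⁿ t - [2ⁿ t]) ξ_{[2ⁿ t]}^{(n)}` of the walk.
(At `t = 1`, the factor of `ξ` is `0`.) -/
def interpFun (e : List Bool → ℝ) (n : ℕ) (t : ℝ) : ℝ :=
  walk e n ⌊2 ^ n * t⌋₊ + (2 ^ n * t - ⌊2 ^ n * t⌋₊) * step e n ⌊2 ^ n * t⌋₊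

theorem interpFun_eq_sum (e : List Bool → ℝ) (n : ℕ) {t : ℝ} (h0 : 0 ≤ t) (h1 : t ≤ 1) :
    interpFun e n t =
      ∑ k ∈ Finset.range (2 ^ n + 1), max 0 (min 1 (2 ^ n * t - k)) * step e n k := by
  unfold interpFun walk
  set x : ℝ := 2 ^ n * t with hx
  have hx0 : 0 ≤ x := by positivity
  set m := ⌊x⌋₊ with hm
  have hmx : (m : ℝ) ≤ x := Nat.floor_le hx0
  have hxm : x < m + 1 := Nat.lt_floor_add_one x
  have hmn : m ≤ 2 ^ n := by
    have : (m : ℝ) ≤ ((2 ^ n : ℕ) : ℝ) := by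
      push_cast
      exact hmx.trans (mul_le_of_le_one_right (by positivity) h1)
    exact_mod_cast this
  have hsub : Finset.range (m + 1) ⊆ Finset.range (2 ^ n + 1) :=
    Finset.range_subset_range.2 (by omega)
  rw [← Finset.sum_subset hsub, Finset.sum_range_succ]
  · congr 1
    · refine Finset.sum_congr rfl fun k hk => ?_
      have hkm : (k : ℝ) + 1 ≤ m := by
        have := Finset.mem_range.1 hk
        exact_mod_cast this
      rw [min_eq_left (by linarith), max_eq_right zero_le_one, one_mul]
    · rw [min_eq_right (by linarith), max_eq_right (by linarith)]
  · intro k _ hk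
    have hkm : (m : ℝ) + 1 ≤ k := by
      have : m + 1 ≤ k := by simpa using hk
      exact_mod_cast this
    rw [max_eq_left ((min_le_right _ _).trans (by linarith)), zero_mul]

theorem continuous_interpFun (e : List Bool → ℝ) (n : ℕ) :
    Continuous fun t : unitInterval => interpFun e n t := by
  have h : (fun t : unitInterval => interpFun e n t) = fun t : unitInterval =>
      ∑ k ∈ Finset.range (2 ^ n + 1), max 0 (min 1 (2 ^ n * (t : ℝ) - k)) * step e n k :=
    funext fun t => interpFun_eq_sum e n t.2.1 t.2.2
  rw [h]
  fun_prop

/-- The interpolated walk as an element of `C([0,1])`. -/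
def interp (e : List Bool → ℝ) (n : ℕ) : C(unitInterval, ℝ) :=
  ⟨fun t => interpFun e n t, continuous_interpFun e n⟩

/-- `B_n = 2^{-nH} [S_{[2ⁿ t]} + (2ⁿ t - [2ⁿ t]) ξ_{[2ⁿ t]}]`, for a finite exponent `H`. -/
def cascade (H : ℝ) (e : List Bool → ℝ) (n : ℕ) : C(unitInterval, ℝ) :=
  (2 : ℝ) ^ (-(n * H)) • interp e n

/-- The constant `σ`, for a finite exponent `H ≤ 1/2`. -/
def sigma (H : ℝ) : ℝ :=
  if H < 1 / 2 then √(1 + ((2 : ℝ) ^ (2 - 2 * H) - 2)⁻¹) else 1 / √2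

/-- The normalized process `X_n` for a finite exponent `H ≤ 1/2`: it is
`B_n / (σ 2^{n(1/2 - H)})` if `H < 1/2` and `B_n / (σ √n)` if `H = 1/2`. -/
def normalizedReal (H : ℝ) (e : List Bool → ℝ) (n : ℕ) : C(unitInterval, ℝ) :=
  if H < 1 / 2 then (sigma H * (2 : ℝ) ^ (n * (1 / 2 - H)))⁻¹ • cascade H e n
  else (sigma H * √n)⁻¹ • cascade H e n

/-- The normalized process `X_n` for `H ∈ [-∞, 1/2]`; for `H = -∞` it is
`2^{-n/2} [S_{[2ⁿ t]} + (2ⁿ t - [2ⁿ t]) ξ_{[2ⁿ t]}]`. -/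
def normalized (H : EReal) (e : List Bool → ℝ) (n : ℕ) : C(unitInterval, ℝ) :=
  if H = ⊥ then (√(2 ^ n))⁻¹ • interp e n else normalizedReal H.toReal e n

/-! ### Brownian motion on `[0,1]` -/

/-- `W` is the law on `C([0,1])` of a standard Brownian motion restricted to `[0,1]`: under `W`,
the coordinate process starts from `0`, has independent increments, and its increment between
`s ≤ t` is centered Gaussian with variance `t - s`. -/
structure IsWienerMeasure (W : Measure C(unitInterval, ℝ)) : Prop where
  start_zero : ∀ᵐ f ∂W, f 0 = 0
  indep_increments : HasIndepIncrements (fun (t : unitInterval) (f : C(unitInterval, ℝ)) => f t) W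
  gaussian_increments : ∀ s t : unitInterval, s ≤ t →
    HasLaw (fun f : C(unitInterval, ℝ) => f t - f s) (gaussianReal 0 (Real.toNNReal (t - s))) W

end SignedCascade

end

/-! Cutting the tree at its root writes the sum of the steps of level `n + 1` as `ε Y + ε' Y'`,
where `Y`, `Y'` are independent copies of the sum of level `n` and `ε`, `ε'` are independent signs
of mean `m = 2^(H-1)` (`0` if `H = -∞`). The hypothesis `H ≤ 1/2` enters as `m ^ 2 ≤ 1 / 2`.

Moments. The mean is `u_n = (2m)^n`, and the second moment satisfies `s_(n+1) = 2 s_n + 2 m² u_n²`.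
From `m² ≤ 1/2` follows `n u_n² ≤ 2 s_n`, so the mean is negligible at scale `√s_n` and `s_(n+p) ∼
2^p s_n`, even in the critical case. The fourth moment is at most `9 s_n²`. The normalizations of
the theorem are exactly factors `c_n` with `c_n² s_n → 1` (`tendsto_normalizer`).

Finite-dimensional laws. A sign of mean `m` acts on a characteristic function by multiplying its
imaginary part by `m`. This map is a contraction fixing the reals, so the `p` top levels of the tree
cannot spoil an approximation of the blocks below by real numbers: the characteristic function over
`2^p` blocks is close to a product (`norm_treeChar_sub_prod_le`). Expanding each block to second
order gives the Gaussian limit (`tendsto_treeChar_const`) and, with one weight per block,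
independent Gaussian dyadic increments (`tendsto_treeChar_block`).

Functional convergence. The fourth moments bound those of dyadic increments of level `p` by a
multiple of `4^(-p)`, whence tightness by chaining and Arzelà–Ascoli. By Prokhorov limit points
exist; each has the Brownian dyadic increments, which determine a law on `C([0,1])` and make it a
Wiener measure. The existence of Brownian motion is thus obtained rather than assumed. -/

noncomputable section

namespace SignedCascade

/-! ### Weighted sums of the steps and their recursion -/

/-- The family of signs read in the subtree of the words starting with `b`. -/
def shift {α : Type*} (e : List Bool → α) (b : Bool) (w : List Bool) : α := e (b :: w)

/-- The weighted sum `∑_{k < 2 ^ n} lam k * ξ_k` of the steps of level `n`. -/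
def stepSum (e : List Bool → ℝ) (n : ℕ) (lam : ℕ → ℝ) : ℝ :=
  ∑ k ∈ Finset.range (2 ^ n), lam k * step e n k

theorem signProd_cons (e : List Bool → ℝ) (b : Bool) (w : List Bool) :
    signProd e (b :: w) = e [b] * signProd (shift e b) w := by
  unfold signProd shift
  rw [List.length_cons, Finset.prod_range_succ', mul_comm]
  simp

theorem dyadicWord_two_pow_add (n m k : ℕ) (h : n ≤ m) :
    dyadicWord n (2 ^ m + k) = dyadicWord n k := by
  induction n with
  | zero => rfl
  | succ n ih => rw [dyadicWord, dyadicWord, ih (by omega), Nat.testBit_two_pow_add_gt (by omega)]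

theorem step_succ_of_lt (e : List Bool → ℝ) {n k : ℕ} (hk : k < 2 ^ n) :
    step e (n + 1) k = e [false] * step (shift e false) n k := by
  rw [step, dyadicWord, signProd_cons, Nat.testBit_lt_two_pow hk, step]

theorem step_succ_two_pow_add (e : List Bool → ℝ) {n k : ℕ} (hk : k < 2 ^ n) :
    step e (n + 1) (2 ^ n + k) = e [true] * step (shift e true) n k := by
  rw [step, dyadicWord, signProd_cons, Nat.testBit_two_pow_add_eq, Nat.testBit_lt_two_pow hk, step,
    dyadicWord_two_pow_add _ _ _ le_rfl]
  rfl

theorem stepSum_zero (e : List Bool → ℝ) (lam : ℕ → ℝ) : stepSum e 0 lam = lam 0 := by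
  simp [stepSum, step, dyadicWord, signProd]

/-- The first digit of a word is the leading binary digit of its index: indices below `2 ^ n` lie in
the left subtree, the others in the right one, and the sign at the root of each subtree factors out.
-/
theorem stepSum_succ (e : List Bool → ℝ) (n : ℕ) (lam : ℕ → ℝ) :
    stepSum e (n + 1) lam = e [false] * stepSum (shift e false) n lam +
      e [true] * stepSum (shift e true) n (fun k => lam (2 ^ n + k)) := by
  unfold stepSum
  rw [pow_succ, mul_two, Finset.sum_range_add, Finset.mul_sum, Finset.mul_sum]
  congr 1 <;> refine Finset.sum_congr rfl fun k hk => ?_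
  · rw [step_succ_of_lt e (Finset.mem_range.1 hk)]; ring
  · rw [step_succ_two_pow_add e (Finset.mem_range.1 hk)]; ring

theorem stepSum_congr (e : List Bool → ℝ) (n : ℕ) {lam lam' : ℕ → ℝ}
    (h : ∀ k < 2 ^ n, lam k = lam' k) : stepSum e n lam = stepSum e n lam' :=
  Finset.sum_congr rfl fun k hk => by rw [h k (Finset.mem_range.1 hk)]

theorem stepSum_const_mul (e : List Bool → ℝ) (n : ℕ) (c : ℝ) (lam : ℕ → ℝ) :
    stepSum e n (fun k => c * lam k) = c * stepSum e n lam := by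
  simp only [stepSum, Finset.mul_sum, mul_assoc]

/-- The sign of the empty word enters no product, so its measurability is not required. This
exclusion matters when the lemma is applied with a sub-σ-algebra generated by part of the signs. -/
theorem measurable_stepSum {Ω : Type*} [MeasurableSpace Ω] (ε : List Bool → Ω → ℝ)
    (h : ∀ w, w ≠ [] → Measurable (ε w)) (n : ℕ) (lam : ℕ → ℝ) :
    Measurable fun ω => stepSum (fun w => ε w ω) n lam := by
  induction n generalizing ε lam with
  | zero => simp only [stepSum_zero]; fun_prop
  | succ n ih =>
    simp only [stepSum_succ]
    have h1 := ih (fun w => ε (false :: w)) (fun w _ => h _ (by simp)) lam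
    have h2 := ih (fun w => ε (true :: w)) (fun w _ => h _ (by simp)) (fun k => lam (2 ^ n + k))
    have h3 := h [false] (by simp)
    have h4 := h [true] (by simp)
    exact (h3.mul h1).add (h4.mul h2)

/-! ### Families of independent random signs -/

/-- The `σ`-algebra generated by the signs of the words in `S`. -/
abbrev signSigma {Ω : Type*} (ε : List Bool → Ω → ℝ) (S : Set (List Bool)) : MeasurableSpace Ω :=
  ⨆ w ∈ S, MeasurableSpace.comap (ε w) inferInstance

theorem measurable_signSigma {Ω : Type*} (ε : List Bool → Ω → ℝ) {S : Set (List Bool)}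
    {w : List Bool} (hw : w ∈ S) : Measurable[signSigma ε S] (ε w) :=
  Measurable.mono (comap_measurable (ε w))
    (le_iSup₂_of_le (f := fun w (_ : w ∈ S) => MeasurableSpace.comap (ε w) inferInstance) w hw
      le_rfl) le_rfl

/-- A family of independent random variables, indexed by the words, with values in `{1, -1}` and
with mean `m`. -/
structure IsSignFamily {Ω : Type*} [MeasurableSpace Ω] (P : Measure Ω) (m : ℝ)
    (ε : List Bool → Ω → ℝ) : Prop where
  measurable : ∀ w, Measurable (ε w)
  indep : iIndepFun ε P
  eq_one_or : ∀ w ω, ε w ω = 1 ∨ ε w ω = -1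
  mean : ∀ w, ∫ ω, ε w ω ∂P = m

namespace IsSignFamily

variable {Ω : Type*} [MeasurableSpace Ω] {P : Measure Ω} {m : ℝ} {ε : List Bool → Ω → ℝ}

theorem shift (h : IsSignFamily P m ε) (b : Bool) : IsSignFamily P m (shift ε b) where
  measurable w := h.measurable _
  indep := h.indep.precomp (g := fun w => b :: w) (fun u v huv => by simpa using huv)
  eq_one_or w := h.eq_one_or _
  mean w := h.mean _

theorem measurable_stepSum (h : IsSignFamily P m ε) (n : ℕ) (lam : ℕ → ℝ) :
    Measurable fun ω => stepSum (fun w => ε w ω) n lam :=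
  SignedCascade.measurable_stepSum ε (fun w _ => h.measurable w) n lam

theorem sq_eq_one (h : IsSignFamily P m ε) (w : List Bool) (ω : Ω) : ε w ω ^ 2 = 1 := by
  rcases h.eq_one_or w ω with h | h <;> rw [h] <;> norm_num

theorem abs_eq_one (h : IsSignFamily P m ε) (w : List Bool) (ω : Ω) : |ε w ω| = 1 := by
  rcases h.eq_one_or w ω with h | h <;> rw [h] <;> norm_num

theorem abs_stepSum_le (h : IsSignFamily P m ε) (n : ℕ) (lam : ℕ → ℝ) (ω : Ω) :
    |stepSum (fun w => ε w ω) n lam| ≤ ∑ k ∈ Finset.range (2 ^ n), |lam k| := by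
  refine (Finset.abs_sum_le_sum_abs _ _).trans (Finset.sum_le_sum fun k _ => ?_)
  rw [abs_mul, step, signProd, Finset.abs_prod, Finset.prod_eq_one fun i _ => h.abs_eq_one _ ω,
    mul_one]

theorem indepFun_of_disjoint (h : IsSignFamily P m ε) {S T : Set (List Bool)} (hST : Disjoint S T)
    {X Y : Ω → ℝ} (hX : Measurable[signSigma ε S] X) (hY : Measurable[signSigma ε T] Y) :
    IndepFun X Y P := by
  rw [IndepFun_iff_Indep]
  exact indep_of_indep_of_le_left (indep_of_indep_of_le_right
    (indep_iSup_of_disjoint (fun w => (h.measurable w).comap_le) h.indep hST) hY.comap_le)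
    hX.comap_le

theorem indepFun_sign_stepSum (h : IsSignFamily P m ε) (b : Bool) (n : ℕ) (lam : ℕ → ℝ) :
    IndepFun (ε [b]) (fun ω => stepSum (fun w => SignedCascade.shift ε b w ω) n lam) P := by
  -- In the subtree below `[b]`, the sign `ε [b]` sits at the root, where it is never read; the sum
  -- therefore depends only on the other words.
  refine h.indepFun_of_disjoint (S := {[b]}) (T := {[b]}ᶜ) disjoint_compl_right
    (measurable_signSigma ε rfl) ?_
  refine @SignedCascade.measurable_stepSum Ω (signSigma ε _) _
    (fun w hw => measurable_signSigma ε ?_) n lam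
  simpa using hw

theorem indepFun_stepSum (h : IsSignFamily P m ε) (n : ℕ) (lam lam' : ℕ → ℝ) :
    IndepFun (fun ω => ε [false] ω * stepSum (fun w => SignedCascade.shift ε false w ω) n lam)
      (fun ω => ε [true] ω * stepSum (fun w => SignedCascade.shift ε true w ω) n lam') P := by
  -- Each of the two terms reads only words with a prescribed first letter, and these two sets of
  -- words are disjoint.
  have key : ∀ (b : Bool) (lam : ℕ → ℝ),
      Measurable[signSigma ε {w : List Bool | w.head? = some b}]
      (fun ω => ε [b] ω * stepSum (fun w => SignedCascade.shift ε b w ω) n lam) := by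
    intro b lam
    have h1 : Measurable[signSigma ε {w : List Bool | w.head? = some b}]
        (fun ω => stepSum (fun w => SignedCascade.shift ε b w ω) n lam) :=
      @SignedCascade.measurable_stepSum Ω (signSigma ε _) _
        (fun w _ => measurable_signSigma ε (w := b :: w) rfl) n lam
    exact Measurable.mul (measurable_signSigma ε (w := [b]) rfl) h1
  refine h.indepFun_of_disjoint ?_ (key false lam) (key true lam')
  rw [Set.disjoint_left]
  intro w hw hw'
  simp_all

variable [IsProbabilityMeasure P]

theorem integrable_of_bounded {X : Ω → ℝ} (hX : Measurable X) {C : ℝ} (hC : ∀ ω, |X ω| ≤ C) :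
    Integrable X P :=
  Integrable.of_bound hX.aestronglyMeasurable C (Eventually.of_forall hC)

theorem integrable_pow (h : IsSignFamily P m ε) (n : ℕ) (lam : ℕ → ℝ) (k : ℕ) :
    Integrable (fun ω => stepSum (fun w => ε w ω) n lam ^ k) P := by
  refine integrable_of_bounded ((h.measurable_stepSum n lam).pow_const k)
    (C := (∑ k ∈ Finset.range (2 ^ n), |lam k|) ^ k) fun ω => ?_
  rw [abs_pow]
  exact pow_le_pow_left₀ (abs_nonneg _) (h.abs_stepSum_le n lam ω) k

end IsSignFamily

/-- The characteristic function at `1` of `ε Y` is the image by `damp m` of that of `Y`, when the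
sign `ε` has mean `m` and is independent of `Y`. -/
def damp (m : ℝ) (z : ℂ) : ℂ := ⟨z.re, m * z.im⟩

/-- The characteristic function at `1` of the sum `stepSum` with weights `lam`, computed through the
branching recursion. -/
def treeChar (m : ℝ) : ℕ → (ℕ → ℝ) → ℂ
  | 0, lam => Complex.exp (lam 0 * Complex.I)
  | n + 1, lam => damp m (treeChar m n lam) * damp m (treeChar m n fun k => lam (2 ^ n + k))

namespace IsSignFamily

variable {Ω : Type*} [MeasurableSpace Ω] {P : Measure Ω} {m : ℝ} {ε : List Bool → Ω → ℝ}
  [IsProbabilityMeasure P]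

theorem integral_exp_mul_I {Y : Ω → ℝ} (hY : Measurable Y) :
    ∫ ω, Complex.exp (Y ω * Complex.I) ∂P = ⟨∫ ω, Real.cos (Y ω) ∂P, ∫ ω, Real.sin (Y ω) ∂P⟩ := by
  have hi : Integrable (fun ω => Complex.exp (Y ω * Complex.I)) P :=
    Integrable.of_bound (by fun_prop) 1
      (Eventually.of_forall fun ω => (Complex.norm_exp_ofReal_mul_I _).le)
  apply Complex.ext
  · have := integral_re hi
    simpa [Complex.exp_ofReal_mul_I_re] using this.symm
  · have := integral_im hi
    simpa [Complex.exp_ofReal_mul_I_im] using this.symm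

/-- Cosine is even and sine is odd, so the sign disappears from the real part and factors out of the
imaginary part, where independence replaces it by its mean. -/
theorem integral_exp_sign_mul {s Y : Ω → ℝ} (hs : Measurable s) (hY : Measurable Y)
    (hs1 : ∀ ω, s ω = 1 ∨ s ω = -1) (hsm : ∫ ω, s ω ∂P = m) (hind : IndepFun s Y P) :
    ∫ ω, Complex.exp ((s ω * Y ω : ℝ) * Complex.I) ∂P =
      damp m (∫ ω, Complex.exp (Y ω * Complex.I) ∂P) := by
  rw [integral_exp_mul_I hY, integral_exp_mul_I (Y := fun ω => s ω * Y ω) (hs.mul hY), damp]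
  congr 1
  · refine integral_congr_ae (Eventually.of_forall fun ω => ?_)
    rcases hs1 ω with h | h <;> simp [h]
  · have h1 : ∀ ω, Real.sin (s ω * Y ω) = s ω * Real.sin (Y ω) := fun ω => by
      rcases hs1 ω with h | h <;> simp [h]
    simp_rw [h1]
    have := IndepFun.integral_fun_mul_eq_mul_integral
      (hind.comp measurable_id Real.measurable_sin) (by fun_prop) (by fun_prop)
    simpa [hsm] using this

theorem integral_exp_stepSum (h : IsSignFamily P m ε) (n : ℕ) (lam : ℕ → ℝ) :
    ∫ ω, Complex.exp ((stepSum (fun w => ε w ω) n lam : ℝ) * Complex.I) ∂P =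
      treeChar m n lam := by
  induction n generalizing ε lam with
  | zero => simp [stepSum_zero, treeChar]
  | succ n ih =>
    have hm := fun b lam => (h.shift b).measurable_stepSum n lam
    have hs := fun b lam => integral_exp_sign_mul (h.measurable [b]) (hm b lam) (h.eq_one_or [b])
      (h.mean [b]) (h.indepFun_sign_stepSum b n lam)
    simp only [stepSum_succ, treeChar]
    rw [← ih (h.shift false) lam, ← ih (h.shift true), ← hs, ← hs]
    have hexp : Measurable fun x : ℝ => Complex.exp (x * Complex.I) := by fun_prop
    have := IndepFun.integral_fun_mul_eq_mul_integral (𝕜 := ℂ)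
      ((h.indepFun_stepSum n lam fun k => lam (2 ^ n + k)).comp hexp hexp)
      (hexp.comp ((h.measurable [false]).mul (hm false _))).aestronglyMeasurable
      (hexp.comp ((h.measurable [true]).mul (hm true _))).aestronglyMeasurable
    refine Eq.trans ?_ this
    refine integral_congr_ae (Eventually.of_forall fun ω => ?_)
    simp only [Function.comp_apply]
    rw [← Complex.exp_add, ← add_mul, ← Complex.ofReal_add]
    rfl

end IsSignFamily

/-! ### Moments -/

/-- The second moment of the sum of the steps of level `n`, for signs with mean `m`. -/
def secondMoment (m : ℝ) : ℕ → ℝ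
  | 0 => 1
  | n + 1 => 2 * secondMoment m n + 2 * m ^ 2 * ((2 * m) ^ n) ^ 2

theorem two_mul_secondMoment_le (m : ℝ) (n : ℕ) :
    2 * secondMoment m n ≤ secondMoment m (n + 1) := by
  rw [secondMoment]
  have : 0 ≤ 2 * m ^ 2 * ((2 * m) ^ n) ^ 2 := by positivity
  linarith

theorem two_pow_le_secondMoment (m : ℝ) (n : ℕ) : 2 ^ n ≤ secondMoment m n := by
  induction n with
  | zero => simp [secondMoment]
  | succ n ih => have := two_mul_secondMoment_le m n; rw [pow_succ]; linarith

theorem secondMoment_pos (m : ℝ) (n : ℕ) : 0 < secondMoment m n :=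
  lt_of_lt_of_le (by positivity) (two_pow_le_secondMoment m n)

namespace IsSignFamily

variable {Ω : Type*} [MeasurableSpace Ω] {P : Measure Ω} {m : ℝ} {ε : List Bool → Ω → ℝ}

theorem integral_sign_mul_pow (h : IsSignFamily P m ε) (b : Bool) (n : ℕ) (lam : ℕ → ℝ) (k : ℕ) :
    ∫ ω, ε [b] ω * stepSum (fun w => SignedCascade.shift ε b w ω) n lam ^ k ∂P =
      m * ∫ ω, stepSum (fun w => SignedCascade.shift ε b w ω) n lam ^ k ∂P := by
  have := ((h.indepFun_sign_stepSum b n lam).comp measurable_id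
    (measurable_id.pow_const k)).integral_fun_mul_eq_mul_integral
    (h.measurable _).aestronglyMeasurable
    (((h.shift b).measurable_stepSum n lam).pow_const k).aestronglyMeasurable
  simpa [h.mean] using this

theorem integral_mul_pow (h : IsSignFamily P m ε) (n : ℕ) (lam lam' : ℕ → ℝ) (k l : ℕ) :
    ∫ ω, (ε [false] ω * stepSum (fun w => SignedCascade.shift ε false w ω) n lam) ^ k *
      (ε [true] ω * stepSum (fun w => SignedCascade.shift ε true w ω) n lam') ^ l ∂P =
    (∫ ω, (ε [false] ω * stepSum (fun w => SignedCascade.shift ε false w ω) n lam) ^ k ∂P) *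
      ∫ ω, (ε [true] ω * stepSum (fun w => SignedCascade.shift ε true w ω) n lam') ^ l ∂P := by
  have hm := fun b lam => (h.measurable [b]).mul ((h.shift b).measurable_stepSum n lam)
  exact ((h.indepFun_stepSum n lam lam').comp (measurable_id.pow_const k)
    (measurable_id.pow_const l)).integral_fun_mul_eq_mul_integral
    ((hm _ _).pow_const k).aestronglyMeasurable ((hm _ _).pow_const l).aestronglyMeasurable

theorem abs_branch_le (h : IsSignFamily P m ε) (b : Bool) (n : ℕ) (lam : ℕ → ℝ) (ω : Ω) :
    |ε [b] ω * stepSum (fun w => SignedCascade.shift ε b w ω) n lam| ≤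
      ∑ k ∈ Finset.range (2 ^ n), |lam k| := by
  rw [abs_mul, h.abs_eq_one, one_mul]
  exact (h.shift b).abs_stepSum_le n _ ω

variable [IsProbabilityMeasure P]

theorem integral_stepSum_one (h : IsSignFamily P m ε) (n : ℕ) :
    ∫ ω, stepSum (fun w => ε w ω) n (fun _ => 1) ∂P = (2 * m) ^ n := by
  induction n generalizing ε with
  | zero => simp [stepSum_zero]
  | succ n ih =>
    have hU := fun b => h.integral_sign_mul_pow b n (fun _ => 1) 1
    simp only [pow_one] at hU
    have hi : ∀ b, Integrable (fun ω => ε [b] ω *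
        stepSum (fun w => SignedCascade.shift ε b w ω) n fun _ => 1) P := fun b =>
      integrable_of_bounded ((h.measurable _).mul ((h.shift b).measurable_stepSum n _))
        (h.abs_branch_le b n _)
    simp only [stepSum_succ]
    refine (integral_add (hi false) (hi true)).trans ?_
    rw [hU, hU, ih (h.shift _), ih (h.shift _)]
    ring

theorem integrable_branch (h : IsSignFamily P m ε) (n : ℕ) (lam lam' : ℕ → ℝ) (k l : ℕ) :
    Integrable (fun ω =>
      (ε [false] ω * stepSum (fun w => SignedCascade.shift ε false w ω) n lam) ^ k *
      (ε [true] ω * stepSum (fun w => SignedCascade.shift ε true w ω) n lam') ^ l) P := by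
  have hm := fun b lam => (h.measurable [b]).mul ((h.shift b).measurable_stepSum n lam)
  refine integrable_of_bounded (((hm _ _).pow_const k).mul ((hm _ _).pow_const l))
    (C := (∑ k ∈ Finset.range (2 ^ n), |lam k|) ^ k * (∑ k ∈ Finset.range (2 ^ n), |lam' k|) ^ l)
    fun ω => ?_
  rw [abs_mul, abs_pow, abs_pow]
  have h1 := h.abs_branch_le false n lam ω
  have h2 := h.abs_branch_le true n lam' ω
  gcongr

theorem integral_stepSum_one_sq (h : IsSignFamily P m ε) (n : ℕ) :
    ∫ ω, stepSum (fun w => ε w ω) n (fun _ => 1) ^ 2 ∂P = secondMoment m n := by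
  induction n generalizing ε with
  | zero => simp [stepSum_zero, secondMoment]
  | succ n ih =>
    have hi := h.integrable_branch n (fun _ => 1) (fun _ => 1)
    have hU := fun b => h.integral_sign_mul_pow b n (fun _ => 1) 1
    have hUV := h.integral_mul_pow n (fun _ => 1) (fun _ => 1) 1 1
    have h20 := hi 2 0
    have h02 := hi 0 2
    have h11 := hi 1 1
    simp only [pow_one, pow_zero, mul_one, one_mul, mul_pow, h.sq_eq_one] at hU hUV h20 h02 h11
    rw [hU, hU, (h.shift _).integral_stepSum_one, (h.shift _).integral_stepSum_one] at hUV
    have hexp : ∀ ω, stepSum (fun w => ε w ω) (n + 1) (fun _ => 1) ^ 2 =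
        stepSum (fun w => SignedCascade.shift ε false w ω) n (fun _ => 1) ^ 2 +
        stepSum (fun w => SignedCascade.shift ε true w ω) n (fun _ => 1) ^ 2 +
        2 * ((ε [false] ω * stepSum (fun w => SignedCascade.shift ε false w ω) n fun _ => 1) *
        (ε [true] ω * stepSum (fun w => SignedCascade.shift ε true w ω) n fun _ => 1)) := by
      intro ω
      rw [stepSum_succ, add_sq, mul_pow, mul_pow, h.sq_eq_one, h.sq_eq_one]
      change 1 * stepSum (fun w => SignedCascade.shift ε false w ω) n (fun _ => 1) ^ 2 +
        2 * (ε [false] ω * stepSum (fun w => SignedCascade.shift ε false w ω) n fun _ => 1) *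
        (ε [true] ω * stepSum (fun w => SignedCascade.shift ε true w ω) n fun _ => 1) +
        1 * stepSum (fun w => SignedCascade.shift ε true w ω) n (fun _ => 1) ^ 2 = _
      ring
    simp_rw [hexp]
    rw [integral_add (h20.fun_add h02) (h11.const_mul 2), integral_add h20 h02, integral_const_mul, hUV,
      ih (h.shift _), ih (h.shift _), secondMoment]
    ring

theorem sq_mean_le_secondMoment (h : IsSignFamily P m ε) (n : ℕ) :
    ((2 * m) ^ n) ^ 2 ≤ secondMoment m n := by
  have hi1 := h.integrable_pow n (fun _ => 1) 1
  simp only [pow_one] at hi1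
  have h0 : 0 ≤ ∫ ω, (stepSum (fun w => ε w ω) n (fun _ => 1) - (2 * m) ^ n) ^ 2 ∂P :=
    integral_nonneg fun ω => sq_nonneg _
  have hexp : ∀ ω, (stepSum (fun w => ε w ω) n (fun _ => 1) - (2 * m) ^ n) ^ 2 =
      stepSum (fun w => ε w ω) n (fun _ => 1) ^ 2 +
      (-2 * (2 * m) ^ n) * stepSum (fun w => ε w ω) n (fun _ => 1) + ((2 * m) ^ n) ^ 2 :=
    fun ω => by ring
  simp_rw [hexp] at h0
  rw [integral_add ((h.integrable_pow n _ 2).fun_add (hi1.const_mul _)) (integrable_const _),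
    integral_add (h.integrable_pow n _ 2) (hi1.const_mul _), integral_const_mul,
    h.integral_stepSum_one_sq, h.integral_stepSum_one] at h0
  simp only [integral_const, probReal_univ, smul_eq_mul, one_mul] at h0
  nlinarith

/-- Controls the odd cross terms in the fourth moment recursion. With `u = (2m)^n`, the square `(y²
- 3uy)² ≥ 0` gives `6uy³ ≤ y⁴ + 9u²y²`; multiply by `m²/6 ≤ 1/12`, integrate and use `u² ≤ s_n`. -/
theorem mixed_moment_le (h : IsSignFamily P m ε) (hm : m ^ 2 ≤ 1 / 2) (n : ℕ) :
    m ^ 2 * (2 * m) ^ n * ∫ ω, stepSum (fun w => ε w ω) n (fun _ => 1) ^ 3 ∂P ≤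
      (∫ ω, stepSum (fun w => ε w ω) n (fun _ => 1) ^ 4 ∂P) / 12 +
        3 / 4 * secondMoment m n ^ 2 := by
  have h4 := h.integrable_pow n (fun _ => 1) 4
  have h2 := h.integrable_pow n (fun _ => 1) 2
  have h3 := h.integrable_pow n (fun _ => 1) 3
  have hle : ∫ ω, m ^ 2 * (2 * m) ^ n * stepSum (fun w => ε w ω) n (fun _ => 1) ^ 3 ∂P ≤
      ∫ ω, (1 / 12 * stepSum (fun w => ε w ω) n (fun _ => 1) ^ 4 +
        3 / 4 * ((2 * m) ^ n) ^ 2 * stepSum (fun w => ε w ω) n (fun _ => 1) ^ 2) ∂P := by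
    refine integral_mono (h3.const_mul _) ((h4.const_mul _).add (h2.const_mul _)) fun ω => ?_
    set y := stepSum (fun w => ε w ω) n (fun _ => 1)
    set u := (2 * m) ^ n
    have e1 : 0 ≤ (y ^ 2 - 3 * (u * y)) ^ 2 := sq_nonneg _
    have e2 : 0 ≤ (y ^ 2 + 3 * (u * y)) ^ 2 := sq_nonneg _
    have e3 : 0 ≤ m ^ 2 := sq_nonneg _
    change m ^ 2 * u * y ^ 3 ≤ 1 / 12 * y ^ 4 + 3 / 4 * u ^ 2 * y ^ 2
    have e4 := mul_nonneg e3 e1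
    have e5 : 0 ≤ (1 / 2 - m ^ 2) * (y ^ 4 + 9 * (u * y) ^ 2) :=
      mul_nonneg (by linarith) (by positivity)
    nlinarith
  rw [integral_const_mul, integral_add (h4.const_mul _) (h2.const_mul _), integral_const_mul,
    integral_const_mul, h.integral_stepSum_one_sq] at hle
  have hs := h.sq_mean_le_secondMoment n
  have hp := secondMoment_pos m n
  nlinarith

/-- The constant 9 is what makes the induction close. With `M` the bound `9 s²` at level `n`, the
recursion gives at most `2M + 6s² + 8(M/12 + 3s²/4) = 36 s² = 9 (2s)²`, and `2 s_n ≤ s_(n+1)`. -/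
theorem integral_stepSum_one_pow_four_le (h : IsSignFamily P m ε) (hm : m ^ 2 ≤ 1 / 2) (n : ℕ) :
    ∫ ω, stepSum (fun w => ε w ω) n (fun _ => 1) ^ 4 ∂P ≤ 9 * secondMoment m n ^ 2 := by
  induction n generalizing ε with
  | zero => simp [stepSum_zero, secondMoment]
  | succ n ih =>
    have cube : ∀ b ω, ε [b] ω ^ 3 = ε [b] ω := fun b ω => by
      rw [pow_succ, h.sq_eq_one, one_mul]
    have four : ∀ b ω, ε [b] ω ^ 4 = 1 := fun b ω => by
      rw [show 4 = 2 * 2 from rfl, pow_mul, h.sq_eq_one, one_pow]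
    have hi := h.integrable_branch n (fun _ => 1) (fun _ => 1)
    have hp := h.integral_mul_pow n (fun _ => 1) (fun _ => 1)
    have i40 := hi 4 0
    have i04 := hi 0 4
    have i22 := hi 2 2
    have i31 := hi 3 1
    have i13 := hi 1 3
    have p22 := hp 2 2
    have p31 := hp 3 1
    have p13 := hp 1 3
    have hU1 := fun b => h.integral_sign_mul_pow b n (fun _ => 1) 1
    have hU3 := fun b => h.integral_sign_mul_pow b n (fun _ => 1) 3
    simp only [pow_one, pow_zero, mul_one, one_mul, mul_pow, h.sq_eq_one, cube, four]
      at i40 i04 i22 i31 i13 p22 p31 p13 hU1 hU3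
    rw [hU3, hU1, (h.shift _).integral_stepSum_one] at p31
    rw [hU3, hU1, (h.shift _).integral_stepSum_one] at p13
    rw [(h.shift _).integral_stepSum_one_sq, (h.shift _).integral_stepSum_one_sq] at p22
    have hexp : ∀ ω, stepSum (fun w => ε w ω) (n + 1) (fun _ => 1) ^ 4 =
        stepSum (fun w => SignedCascade.shift ε false w ω) n (fun _ => 1) ^ 4 +
        stepSum (fun w => SignedCascade.shift ε true w ω) n (fun _ => 1) ^ 4 +
        6 * (stepSum (fun w => SignedCascade.shift ε false w ω) n (fun _ => 1) ^ 2 *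
          stepSum (fun w => SignedCascade.shift ε true w ω) n (fun _ => 1) ^ 2) +
        4 * ((ε [false] ω * stepSum (fun w => SignedCascade.shift ε false w ω) n (fun _ => 1) ^ 3) *
        (ε [true] ω * stepSum (fun w => SignedCascade.shift ε true w ω) n fun _ => 1)) +
        4 * ((ε [false] ω * stepSum (fun w => SignedCascade.shift ε false w ω) n fun _ => 1) *
        (ε [true] ω * stepSum (fun w => SignedCascade.shift ε true w ω) n (fun _ => 1) ^ 3)) := by
      intro ω
      rw [stepSum_succ]
      have e1 := h.sq_eq_one [false] ω
      have e2 := h.sq_eq_one [true] ω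
      have e3 := cube false ω
      have e4 := cube true ω
      have e5 := four false ω
      have e6 := four true ω
      change (ε [false] ω * stepSum (fun w => SignedCascade.shift ε false w ω) n (fun _ => 1) +
        ε [true] ω * stepSum (fun w => SignedCascade.shift ε true w ω) n fun _ => 1) ^ 4 = _
      generalize stepSum (fun w => SignedCascade.shift ε false w ω) n (fun _ => 1) = y
      generalize stepSum (fun w => SignedCascade.shift ε true w ω) n (fun _ => 1) = z
      generalize ε [false] ω = s at *
      generalize ε [true] ω = t at *
      calc (s * y + t * z) ^ 4 = s ^ 4 * y ^ 4 + t ^ 4 * z ^ 4 + 6 * (s ^ 2 * t ^ 2 * (y ^ 2 * z ^ 2))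
            + 4 * (s ^ 3 * y ^ 3 * (t * z)) + 4 * (s * y * (t ^ 3 * z ^ 3)) := by ring
        _ = _ := by rw [e1, e2, e3, e4, e5, e6]; ring
    simp_rw [hexp]
    rw [integral_add (((i40.fun_add i04).fun_add (i22.const_mul 6)).fun_add (i31.const_mul 4))
        (i13.const_mul 4),
      integral_add ((i40.fun_add i04).fun_add (i22.const_mul 6)) (i31.const_mul 4),
      integral_add (i40.fun_add i04) (i22.const_mul 6), integral_add i40 i04, integral_const_mul,
      integral_const_mul, integral_const_mul, p22, p31, p13]
    have f0 := ih (h.shift false)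
    have f1 := ih (h.shift true)
    have g0 := (h.shift false).mixed_moment_le hm n
    have g1 := (h.shift true).mixed_moment_le hm n
    have hs := two_mul_secondMoment_le m n
    have hpos := secondMoment_pos m n
    have hsq : (2 * secondMoment m n) ^ 2 ≤ secondMoment m (n + 1) ^ 2 :=
      pow_le_pow_left₀ (by positivity) hs 2
    nlinarith

/-- Only the subtree over block `j` contributes. The signs on the path leading to it have fourth
power 1, so the moment is that of a full sum of level `q`. -/
theorem integral_stepSum_block_pow_four_le (h : IsSignFamily P m ε) (hm : m ^ 2 ≤ 1 / 2)
    (q p : ℕ) {j : ℕ} (hj : j < 2 ^ p) :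
    ∫ ω, stepSum (fun w => ε w ω) (q + p) (fun k => if k / 2 ^ q = j then 1 else 0) ^ 4 ∂P ≤
      9 * secondMoment m q ^ 2 := by
  induction p generalizing ε j with
  | zero =>
    have hj0 : j = 0 := by simpa using hj
    subst hj0
    refine le_of_eq_of_le ?_ (h.integral_stepSum_one_pow_four_le hm q)
    refine integral_congr_ae (Eventually.of_forall fun ω => ?_)
    change stepSum _ _ _ ^ 4 = _
    rw [stepSum_congr _ _ (lam' := fun _ => 1)]
    · rfl
    · intro k hk
      rw [if_pos (Nat.div_eq_of_lt (by simpa using hk))]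
  | succ p ih =>
    have four : ∀ b ω, ε [b] ω ^ 4 = 1 := fun b ω => by
      rw [show 4 = 2 * 2 from rfl, pow_mul, h.sq_eq_one, one_pow]
    have hzero : ∀ (e : List Bool → ℝ) (lam : ℕ → ℝ), (∀ k < 2 ^ (q + p), lam k = 0) →
        stepSum e (q + p) lam = 0 := fun e lam hl =>
      Finset.sum_eq_zero fun k hk => by rw [hl k (Finset.mem_range.1 hk), zero_mul]
    have hdiv : ∀ k, (2 ^ (q + p) + k) / 2 ^ q = 2 ^ p + k / 2 ^ q := fun k => by
      rw [pow_add, Nat.mul_add_div (by positivity)]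
    have hlt : ∀ k < 2 ^ (q + p), k / 2 ^ q < 2 ^ p := fun k hk => by
      rw [Nat.div_lt_iff_lt_mul (by positivity), ← pow_add, add_comm p q]; exact hk
    rcases lt_or_ge j (2 ^ p) with hjp | hjp
    · refine le_of_eq_of_le ?_ (ih (h.shift false) hjp)
      refine integral_congr_ae (Eventually.of_forall fun ω => ?_)
      change stepSum _ (q + p + 1) _ ^ 4 = _
      rw [stepSum_succ, hzero (SignedCascade.shift (fun w => ε w ω) true), mul_zero, add_zero,
        mul_pow, four, one_mul]
      · rfl
      · intro k hk
        have : 2 ^ p + k / 2 ^ q ≠ j := by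
          generalize k / 2 ^ q = d
          omega
        rw [hdiv, if_neg this]
    · have hj' : j - 2 ^ p < 2 ^ p := by rw [pow_succ] at hj; omega
      refine le_of_eq_of_le ?_ (ih (h.shift true) hj')
      refine integral_congr_ae (Eventually.of_forall fun ω => ?_)
      change stepSum _ (q + p + 1) _ ^ 4 = _
      rw [stepSum_succ, hzero (SignedCascade.shift (fun w => ε w ω) false), mul_zero, zero_add,
        mul_pow, four, one_mul]
      · congr 1
        refine stepSum_congr _ _ fun k hk => ?_
        simp only [hdiv]
        congr 1
        generalize k / 2 ^ q = d
        exact propext ⟨fun h => by omega, fun h => by omega⟩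
      · intro k hk
        rw [if_neg ((hlt k hk).trans_le hjp).ne]

end IsSignFamily

/-! ### The central limit theorem for the branching recursion -/

theorem norm_damp_le {m : ℝ} (hm : m ^ 2 ≤ 1 / 2) (z : ℂ) : ‖damp m z‖ ≤ ‖z‖ := by
  rw [← sq_le_sq₀ (norm_nonneg _) (norm_nonneg _), Complex.sq_norm, Complex.sq_norm,
    Complex.normSq_apply, Complex.normSq_apply, damp]
  nlinarith [mul_nonneg (sub_nonneg.2 hm) (sq_nonneg z.im), sq_nonneg z.im]

theorem damp_sub (m : ℝ) (z w : ℂ) : damp m (z - w) = damp m z - damp m w := by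
  apply Complex.ext <;> simp [damp]
  ring

theorem damp_ofReal (m x : ℝ) : damp m (x : ℂ) = x := by
  apply Complex.ext <;> simp [damp]

theorem norm_treeChar_le {m : ℝ} (hm : m ^ 2 ≤ 1 / 2) (n : ℕ) (lam : ℕ → ℝ) :
    ‖treeChar m n lam‖ ≤ 1 := by
  induction n generalizing lam with
  | zero => exact (Complex.norm_exp_ofReal_mul_I _).le
  | succ n ih =>
    rw [treeChar, norm_mul]
    exact mul_le_one₀ ((norm_damp_le hm _).trans (ih _)) (norm_nonneg _)
      ((norm_damp_le hm _).trans (ih _))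

theorem treeChar_congr (m : ℝ) (n : ℕ) {lam lam' : ℕ → ℝ} (h : ∀ k < 2 ^ n, lam k = lam' k) :
    treeChar m n lam = treeChar m n lam' := by
  induction n generalizing lam lam' with
  | zero => rw [treeChar, treeChar, h 0 (by simp)]
  | succ n ih =>
    rw [treeChar, treeChar, ih fun k hk => h k ?_, ih fun k hk => h _ ?_]
    · rw [pow_succ]; omega
    · rw [pow_succ]; omega

/-- Comparison of the branching recursion, for weights which are constant on blocks, with a product
of real numbers. -/
theorem norm_treeChar_sub_prod_le {m : ℝ} (hm : m ^ 2 ≤ 1 / 2) (q p : ℕ) (l y : ℕ → ℝ)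
    (hy : ∀ j, |y j| ≤ 1) :
    ‖treeChar m (q + p) (fun k => l (k / 2 ^ q)) - ((∏ j ∈ Finset.range (2 ^ p), y j : ℝ) : ℂ)‖ ≤
      ∑ j ∈ Finset.range (2 ^ p), ‖treeChar m q (fun _ => l j) - (y j : ℂ)‖ := by
  induction p generalizing l y with
  | zero =>
    have h : treeChar m q (fun k => l (k / 2 ^ q)) = treeChar m q fun _ => l 0 :=
      treeChar_congr m q fun k hk => by rw [Nat.div_eq_of_lt hk]
    simp [h]
  | succ p ih =>
    have hdiv : ∀ k, (2 ^ (q + p) + k) / 2 ^ q = 2 ^ p + k / 2 ^ q := fun k => by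
      rw [pow_add, Nat.mul_add_div (by positivity)]
    have ih1 := ih l y hy
    have ih2 := ih (fun j => l (2 ^ p + j)) (fun j => y (2 ^ p + j)) fun j => hy _
    rw [← add_assoc, treeChar, pow_succ, mul_two, Finset.prod_range_add, Finset.sum_range_add]
    simp only [hdiv]
    set A := treeChar m (q + p) fun k => l (k / 2 ^ q)
    set B := treeChar m (q + p) fun k => l (2 ^ p + k / 2 ^ q)
    set a := ∏ j ∈ Finset.range (2 ^ p), y j
    set b := ∏ j ∈ Finset.range (2 ^ p), y (2 ^ p + j)
    have hB : ‖damp m B‖ ≤ 1 := (norm_damp_le hm _).trans (norm_treeChar_le hm _ _)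
    have ha : ‖(a : ℂ)‖ ≤ 1 := by
      rw [Complex.norm_real, Real.norm_eq_abs, Finset.abs_prod]
      exact Finset.prod_le_one (fun _ _ => abs_nonneg _) fun _ _ => hy _
    have hAa : ‖damp m A - a‖ ≤ ‖A - a‖ := by
      rw [← damp_ofReal m a, ← damp_sub, damp_ofReal]; exact norm_damp_le hm _
    have hBb : ‖damp m B - b‖ ≤ ‖B - b‖ := by
      rw [← damp_ofReal m b, ← damp_sub, damp_ofReal]; exact norm_damp_le hm _
    -- Telescoping of a product of factors of modulus at most 1; since `a` and `b` are real, `damp`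
    -- fixes them and only decreases the distances.
    calc ‖damp m A * damp m B - ((a * b : ℝ) : ℂ)‖
        = ‖(damp m A - a) * damp m B + a * (damp m B - b)‖ := by push_cast; ring_nf
      _ ≤ ‖damp m A - a‖ * ‖damp m B‖ + ‖(a : ℂ)‖ * ‖damp m B - b‖ := by
          refine (norm_add_le _ _).trans ?_
          rw [norm_mul, norm_mul]
      _ ≤ ‖damp m A - a‖ * 1 + 1 * ‖damp m B - b‖ := by gcongr
      _ ≤ _ := by linarith

/-- The crude constant 4 also covers `|x| > 1`, where the left side is at most `2 + |x| + x²/2`. -/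
theorem norm_exp_mul_I_sub_le (x : ℝ) :
    ‖Complex.exp (x * Complex.I) - (1 + x * Complex.I - (x ^ 2 / 2 : ℝ))‖ ≤ 4 * |x| ^ 3 := by
  rcases le_or_gt |x| 1 with h | h
  · have h1 : ‖(x : ℂ) * Complex.I‖ = |x| := by simp
    have := Complex.exp_bound (x := x * Complex.I) (by rw [h1]; exact h) (n := 3) (by norm_num)
    rw [h1] at this
    have h2 : ∑ k ∈ Finset.range 3, ((x : ℂ) * Complex.I) ^ k / (k.factorial : ℂ) =
        1 + x * Complex.I - (x ^ 2 / 2 : ℝ) := by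
      simp [Finset.sum_range_succ, mul_pow]
      ring
    rw [h2] at this
    refine this.trans ?_
    rw [mul_comm]
    gcongr
    norm_num [Nat.factorial]
  · have h1 : ‖(1 + x * Complex.I - (x ^ 2 / 2 : ℝ) : ℂ)‖ ≤ 1 + |x| + |x| ^ 2 / 2 := by
      refine (norm_sub_le _ _).trans ?_
      refine add_le_add ((norm_add_le _ _).trans ?_) ?_
      · simp
      · rw [Complex.norm_real, Real.norm_eq_abs, abs_div, abs_pow]; simp
    refine (norm_sub_le _ _).trans ?_
    rw [Complex.norm_exp_ofReal_mul_I]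
    nlinarith [mul_pos (sub_pos.2 h) (sub_pos.2 h), pow_pos (sub_pos.2 h) 3]

/-- This is where criticality is felt: `u_n²` grows by the factor `4m² ≤ 2`, while `s_n` at least
doubles and also receives `2m²u_n²` at each level. The gain of a factor `n` makes the mean
negligible even when `m² = 1/2`. -/
theorem mul_sq_mean_le {m : ℝ} (hm : m ^ 2 ≤ 1 / 2) (n : ℕ) :
    n * ((2 * m) ^ n) ^ 2 ≤ 2 * secondMoment m n := by
  induction n with
  | zero => simp [secondMoment]
  | succ n ih =>
    rw [secondMoment, pow_succ (2 * m)]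
    push_cast
    have h0 : 0 ≤ (n : ℝ) * ((2 * m) ^ n) ^ 2 := by positivity
    nlinarith

theorem tendsto_sq_mean_div_secondMoment {m : ℝ} (hm : m ^ 2 ≤ 1 / 2) :
    Tendsto (fun n => ((2 * m) ^ n) ^ 2 / secondMoment m n) atTop (𝓝 0) := by
  refine squeeze_zero' (g := fun n : ℕ => 2 / (n : ℝ))
    (Eventually.of_forall fun n => div_nonneg (sq_nonneg _) (secondMoment_pos m n).le) ?_
    (tendsto_const_div_atTop_nhds_zero_nat 2)
  filter_upwards [eventually_gt_atTop 0] with n hn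
  rw [div_le_div_iff₀ (secondMoment_pos m n) (by exact_mod_cast hn)]
  linarith [mul_sq_mean_le hm n]

/-- One level multiplies the second moment by `2 + 2m² u_q² / s_q`, which tends to 2. -/
theorem tendsto_secondMoment_ratio {m : ℝ} (hm : m ^ 2 ≤ 1 / 2) (p : ℕ) :
    Tendsto (fun q => secondMoment m q / secondMoment m (q + p)) atTop (𝓝 ((1 / 2) ^ p)) := by
  induction p with
  | zero => simp [div_self (secondMoment_pos m _).ne']
  | succ p ih =>
    have h1 : Tendsto (fun q => secondMoment m q / secondMoment m (q + 1)) atTop (𝓝 (1 / 2)) := by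
      have h2 := (((tendsto_sq_mean_div_secondMoment hm).const_mul (2 * m ^ 2)).const_add
        2).inv₀ (by norm_num)
      rw [mul_zero, add_zero, ← one_div] at h2
      refine h2.congr fun q => ?_
      have := (secondMoment_pos m q).ne'
      rw [← inv_div]
      rw [secondMoment]
      field_simp
    rw [pow_succ]
    refine (ih.mul (h1.comp (tendsto_add_atTop_nat p))).congr fun q => ?_
    have := (secondMoment_pos m (q + p)).ne'
    have := (secondMoment_pos m (q + p + 1)).ne'
    simp only [Function.comp_apply, ← add_assoc]
    field_simp

theorem tendsto_sq_mul_secondMoment {m : ℝ} (hm : m ^ 2 ≤ 1 / 2) {c : ℕ → ℝ} {τ : ℝ}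
    (hc : Tendsto (fun n => c n ^ 2 * secondMoment m n) atTop (𝓝 τ)) (p : ℕ) :
    Tendsto (fun q => c (q + p) ^ 2 * secondMoment m q) atTop (𝓝 (τ * (1 / 2) ^ p)) := by
  refine ((hc.comp (tendsto_add_atTop_nat p)).mul (tendsto_secondMoment_ratio hm p)).congr
    fun q => ?_
  have := (secondMoment_pos m (q + p)).ne'
  simp only [Function.comp_apply]
  field_simp

theorem abs_one_sub_sub_exp_neg_le {x : ℝ} (hx : 0 ≤ x) : |1 - x - Real.exp (-x)| ≤ x ^ 2 := by
  have h1 := Real.add_one_le_exp (-x)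
  rw [abs_le]
  constructor
  · have h2 : Real.exp (-x) * (1 + x) ≤ 1 := by
      have h3 := Real.add_one_le_exp x
      calc Real.exp (-x) * (1 + x) ≤ Real.exp (-x) * Real.exp x := by gcongr; linarith
        _ = 1 := by rw [← Real.exp_add]; simp
    nlinarith [Real.exp_pos (-x), mul_nonneg hx hx, mul_nonneg (mul_nonneg hx hx) hx]
  · nlinarith [sq_nonneg x]

section

variable {Ω : Type*} [MeasurableSpace Ω] {P : Measure Ω} {m : ℝ} {ε : List Bool → Ω → ℝ}
  [IsProbabilityMeasure P]

/-- The Taylor remainder involves a third absolute moment. The inequality `4x³ ≤ 2δx² + 2x⁴/δ`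
trades it for the second and fourth moments, with `δ` left free for optimization. -/
theorem IsSignFamily.norm_treeChar_const_sub_le (h : IsSignFamily P m ε) (hm : m ^ 2 ≤ 1 / 2)
    (q : ℕ) (u : ℝ) {δ : ℝ} (hδ : 0 < δ) :
    ‖treeChar m q (fun _ => u) - (1 + (u * (2 * m) ^ q : ℝ) * Complex.I -
      (u ^ 2 * secondMoment m q / 2 : ℝ))‖ ≤
      2 * (δ * (u ^ 2 * secondMoment m q) + 9 * (u ^ 2 * secondMoment m q) ^ 2 / δ) := by
  set Z : Ω → ℝ := fun ω => stepSum (fun w => ε w ω) q (fun _ => 1) with hZ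
  have hZm : Measurable Z := h.measurable_stepSum q _
  have hZ1 : Integrable Z P := by simpa using h.integrable_pow q (fun _ => 1) 1
  have hZ2 : Integrable (fun ω => Z ω ^ 2) P := h.integrable_pow q (fun _ => 1) 2
  have hZ4 : Integrable (fun ω => Z ω ^ 4) P := h.integrable_pow q (fun _ => 1) 4
  have hchar : treeChar m q (fun _ => u) = ∫ ω, Complex.exp ((u * Z ω : ℝ) * Complex.I) ∂P := by
    rw [← h.integral_exp_stepSum]
    congr 1 with ω
    rw [hZ, ← stepSum_const_mul]
    simp
  have hi1 : Integrable (fun ω => Complex.exp ((u * Z ω : ℝ) * Complex.I)) P :=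
    Integrable.of_bound (by fun_prop) 1
      (Eventually.of_forall fun ω => (Complex.norm_exp_ofReal_mul_I _).le)
  have hi2 : Integrable (fun ω => ((u * Z ω : ℝ) : ℂ) * Complex.I) P :=
    ((hZ1.const_mul u).ofReal).mul_const _
  have hi3 : Integrable (fun ω => (((u * Z ω) ^ 2 / 2 : ℝ) : ℂ)) P := by
    refine Integrable.ofReal ?_
    simp only [mul_pow]
    exact (hZ2.const_mul _).div_const _
  have hpoly : (1 + (u * (2 * m) ^ q : ℝ) * Complex.I - (u ^ 2 * secondMoment m q / 2 : ℝ) : ℂ) =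
      ∫ ω, (1 + (u * Z ω : ℝ) * Complex.I - ((u * Z ω) ^ 2 / 2 : ℝ)) ∂P := by
    rw [integral_sub ((integrable_const _).fun_add hi2) hi3,
      integral_add (integrable_const _) hi2, integral_mul_const, integral_complex_ofReal,
      integral_complex_ofReal, integral_const_mul]
    simp only [mul_pow]
    rw [integral_div, integral_const_mul, h.integral_stepSum_one, h.integral_stepSum_one_sq]
    simp [mul_pow]
  have hi4 : Integrable (fun ω => (1 + (u * Z ω : ℝ) * Complex.I - ((u * Z ω) ^ 2 / 2 : ℝ) : ℂ)) P :=
    ((integrable_const _).fun_add hi2).sub hi3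
  rw [hchar, hpoly, ← integral_sub hi1 hi4]
  have hbi : Integrable (fun ω => 2 * (δ * u ^ 2) * Z ω ^ 2 + 2 * (u ^ 4 / δ) * Z ω ^ 4) P :=
    (hZ2.const_mul _).add (hZ4.const_mul _)
  refine (norm_integral_le_of_norm_le hbi (Eventually.of_forall fun ω => ?_)).trans ?_
  · refine (norm_exp_mul_I_sub_le _).trans ?_
    have key : ∀ x : ℝ, 0 ≤ x → 4 * x ^ 3 ≤ 2 * δ * x ^ 2 + 2 / δ * x ^ 4 := fun x hx => by
      have : 0 ≤ 2 / δ * (x * (x - δ)) ^ 2 := by positivity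
      have e : 2 / δ * (x * (x - δ)) ^ 2 = 2 / δ * x ^ 4 - 4 * x ^ 3 + 2 * δ * x ^ 2 := by
        field_simp; ring
      linarith
    refine (key _ (abs_nonneg _)).trans (le_of_eq ?_)
    rw [sq_abs, show |u * Z ω| ^ 4 = (u * Z ω) ^ 4 from Even.pow_abs (by decide) _]
    ring
  · rw [integral_add (hZ2.const_mul _) (hZ4.const_mul _), integral_const_mul, integral_const_mul,
      h.integral_stepSum_one_sq]
    have := h.integral_stepSum_one_pow_four_le hm q
    have h5 : 0 ≤ 2 * (u ^ 4 / δ) := by positivity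
    have := mul_le_mul_of_nonneg_left this h5
    refine (add_le_add le_rfl this).trans (le_of_eq ?_)
    ring

/-- The top `p` levels are cut off, leaving `2^p` blocks of limiting second moment `η = τ 2^(-p)`,
each compared with `exp(-η/2)`. First `n → ∞` with `p` fixed, then `p → ∞`. -/
theorem IsSignFamily.tendsto_treeChar_const (h : IsSignFamily P m ε) (hm : m ^ 2 ≤ 1 / 2)
    {c : ℕ → ℝ} {τ : ℝ} (hc : Tendsto (fun n => c n ^ 2 * secondMoment m n) atTop (𝓝 τ)) :
    Tendsto (fun n => treeChar m n fun _ => c n) atTop (𝓝 ((Real.exp (-(τ / 2)) : ℝ) : ℂ)) := by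
  have hτ : 0 ≤ τ := ge_of_tendsto' hc fun n =>
    mul_nonneg (sq_nonneg _) (secondMoment_pos m n).le
  rw [tendsto_iff_norm_sub_tendsto_zero]
  -- the bound obtained by cutting the tree at level `2 r`
  have hbound : ∀ r : ℕ, ∃ b : ℕ → ℝ, Tendsto b atTop (𝓝 ((2 * τ + 19 * τ ^ 2) * (1 / 2) ^ r)) ∧
      ∀ᶠ n in atTop, ‖(treeChar m n fun _ => c n) - ((Real.exp (-(τ / 2)) : ℝ) : ℂ)‖ ≤ b n := by
    intro r
    -- With `p = 2r` and `δ = 2^(-r)`, one has `2^p δ² = 1`. The block errors `δη` and `η²/δ`,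
    -- summed over `2^p` blocks, become `τδ` and `τ²δ`, both small.
    set p := 2 * r with hp
    set δ : ℝ := (1 / 2) ^ r with hδ
    have hδ0 : 0 < δ := by positivity
    have hδp : (1 / 2 : ℝ) ^ p = δ ^ 2 := by rw [hp, hδ, mul_comm, pow_mul]
    have h2p : (2 : ℝ) ^ p * δ ^ 2 = 1 := by rw [← hδp, ← mul_pow]; norm_num
    set η : ℝ := τ * (1 / 2) ^ p with hη
    have hη0 : 0 ≤ η := by positivity
    have hs := tendsto_sq_mul_secondMoment hm hc p
    -- The squared mean is the product of the bounded quantity `c² s_q` and of `u_q² / s_q → 0`.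
    have hμ : Tendsto (fun q => |c (q + p) * (2 * m) ^ q|) atTop (𝓝 0) := by
      have h1 := (hs.mul (tendsto_sq_mean_div_secondMoment hm)).sqrt
      rw [mul_zero, Real.sqrt_zero] at h1
      refine h1.congr fun q => ?_
      rw [← Real.sqrt_sq_eq_abs]
      congr 1
      have := (secondMoment_pos m q).ne'
      field_simp
    set g : ℕ → ℝ := fun q => 2 ^ p * (|c (q + p) * (2 * m) ^ q| +
      2 * (δ * (c (q + p) ^ 2 * secondMoment m q) +
        9 * (c (q + p) ^ 2 * secondMoment m q) ^ 2 / δ) +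
      |1 - c (q + p) ^ 2 * secondMoment m q / 2 - Real.exp (-(η / 2))|) with hg
    have hglim : Tendsto g atTop (𝓝 (2 ^ p * (0 + 2 * (δ * η + 9 * η ^ 2 / δ) +
        |1 - η / 2 - Real.exp (-(η / 2))|))) := by
      refine Tendsto.const_mul _ ((hμ.add (((hs.const_mul δ).add
        (((hs.pow 2).const_mul 9).div_const δ)).const_mul 2)).add ?_)
      exact ((((hs.div_const 2).const_sub 1).sub_const _).abs)
    have hgle : ∀ q, ‖(treeChar m (q + p) fun _ => c (q + p)) -
        ((Real.exp (-(τ / 2)) : ℝ) : ℂ)‖ ≤ g q := by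
      intro q
      have h1 := norm_treeChar_sub_prod_le hm q p (fun _ => c (q + p))
        (fun _ => Real.exp (-(η / 2))) fun _ => by
          rw [abs_of_pos (Real.exp_pos _)]
          exact Real.exp_le_one_iff.2 (by linarith)
      have h2 : Real.exp (-(η / 2)) ^ 2 ^ p = Real.exp (-(τ / 2)) := by
        rw [← Real.exp_nat_mul]
        congr 1
        push_cast
        rw [hη, hδp]
        linear_combination (-τ / 2) * h2p
      simp only [Finset.prod_const, Finset.sum_const, Finset.card_range, h2, nsmul_eq_mul,
        Nat.cast_pow, Nat.cast_ofNat] at h1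
      refine h1.trans ?_
      rw [hg]
      refine mul_le_mul_of_nonneg_left ?_ (by positivity)
      have h3 := h.norm_treeChar_const_sub_le hm q (c (q + p)) hδ0
      set T := treeChar m q fun _ => c (q + p)
      set x := c (q + p) ^ 2 * secondMoment m q
      set v := c (q + p) * (2 * m) ^ q
      have e : T - ((Real.exp (-(η / 2)) : ℝ) : ℂ) = (T - (1 + (v : ℝ) * Complex.I - (x / 2 : ℝ))) +
          (v : ℝ) * Complex.I + ((1 - x / 2 - Real.exp (-(η / 2)) : ℝ) : ℂ) := by
        push_cast; ring
      rw [e]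
      refine (norm_add₃_le).trans ?_
      have e1 : ‖(v : ℂ) * Complex.I‖ = |v| := by simp
      rw [e1, Complex.norm_real, Real.norm_eq_abs]
      linarith
    -- The constant added to `g` is the gap between the announced limit and that of `g`. It is
    -- nonnegative, so the shifted sequence is still an upper bound.
    refine ⟨fun n => g (n - p) + ((2 * τ + 19 * τ ^ 2) * δ -
      2 ^ p * (0 + 2 * (δ * η + 9 * η ^ 2 / δ) + |1 - η / 2 - Real.exp (-(η / 2))|)), ?_, ?_⟩
    · have := (hglim.comp (tendsto_sub_atTop_nat p)).add_const ((2 * τ + 19 * τ ^ 2) * δ -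
        2 ^ p * (0 + 2 * (δ * η + 9 * η ^ 2 / δ) + |1 - η / 2 - Real.exp (-(η / 2))|))
      rw [add_sub_cancel] at this
      exact this
    · filter_upwards [eventually_ge_atTop p] with n hn
      have h1 := hgle (n - p)
      rw [Nat.sub_add_cancel hn] at h1
      have h2 := abs_one_sub_sub_exp_neg_le (x := η / 2) (by linarith)
      have h3 : (2 : ℝ) ^ p * (0 + 2 * (δ * η + 9 * η ^ 2 / δ) + (η / 2) ^ 2) ≤
          (2 * τ + 19 * τ ^ 2) * δ := by
        have hδ1 : δ ≤ 1 := pow_le_one₀ (by norm_num) (by norm_num)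
        have e : (2 : ℝ) ^ p * (0 + 2 * (δ * η + 9 * η ^ 2 / δ) + (η / 2) ^ 2) =
            (2 ^ p * δ ^ 2) * (2 * τ * δ + 18 * τ ^ 2 * δ + τ ^ 2 * δ ^ 2 / 4) := by
          rw [hη, hδp]; field_simp; ring
        rw [e, h2p]
        nlinarith [mul_nonneg (sq_nonneg τ) hδ0.le,
          mul_nonneg (mul_nonneg (sq_nonneg τ) hδ0.le) (sub_nonneg.2 hδ1)]
      have h4 : (2 : ℝ) ^ p * (0 + 2 * (δ * η + 9 * η ^ 2 / δ) +
          |1 - η / 2 - Real.exp (-(η / 2))|) ≤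
          2 ^ p * (0 + 2 * (δ * η + 9 * η ^ 2 / δ) + (η / 2) ^ 2) := by gcongr
      linarith
  refine tendsto_order.2 ⟨fun a ha => Eventually.of_forall fun n => ha.trans_le (norm_nonneg _),
    fun a ha => ?_⟩
  have hlim : Tendsto (fun r : ℕ => (2 * τ + 19 * τ ^ 2) * (1 / 2 : ℝ) ^ r) atTop (𝓝 0) := by
    simpa using (tendsto_pow_atTop_nhds_zero_of_lt_one (r := (1 / 2 : ℝ)) (by norm_num)
      (by norm_num)).const_mul (2 * τ + 19 * τ ^ 2)
  obtain ⟨r, hr⟩ := (hlim.eventually_lt_const ha).exists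
  obtain ⟨b, hb, hle⟩ := hbound r
  filter_upwards [hle, hb.eventually_lt_const hr] with n h1 h2
  exact h1.trans_lt h2

/-- Convergence of the joint characteristic functions of the sums over the blocks of level `p`. -/
theorem IsSignFamily.tendsto_treeChar_block (h : IsSignFamily P m ε) (hm : m ^ 2 ≤ 1 / 2)
    {c : ℕ → ℝ} (hc : Tendsto (fun n => c n ^ 2 * secondMoment m n) atTop (𝓝 1)) (p : ℕ)
    (l : ℕ → ℝ) :
    Tendsto (fun q => treeChar m (q + p) fun k => c (q + p) * l (k / 2 ^ q)) atTop
      (𝓝 (Real.exp (-(∑ j ∈ Finset.range (2 ^ p), l j ^ 2 * (1 / 2) ^ p) / 2) : ℝ)) := by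
  have hprod : Real.exp (-(∑ j ∈ Finset.range (2 ^ p), l j ^ 2 * (1 / 2) ^ p) / 2) =
      ∏ j ∈ Finset.range (2 ^ p), Real.exp (-(l j ^ 2 * (1 / 2) ^ p / 2)) := by
    rw [← Real.exp_sum, Finset.sum_neg_distrib, ← Finset.sum_div, neg_div]
  rw [hprod, tendsto_iff_norm_sub_tendsto_zero]
  refine squeeze_zero (fun _ => norm_nonneg _)
    (fun q => norm_treeChar_sub_prod_le hm q p (fun j => c (q + p) * l j) _ fun j => ?_) ?_
  · rw [abs_of_pos (Real.exp_pos _)]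
    exact Real.exp_le_one_iff.2 (neg_nonpos.2 (by positivity))
  · refine (tendsto_finsetSum (a := fun _ => (0 : ℝ)) _ fun j _ => ?_).trans (by simp)
    rw [← tendsto_iff_norm_sub_tendsto_zero]
    -- Each block is a tree of constant weight, whose normalized second moment tends to `l j ^ 2 *
    -- (1 / 2) ^ p`.
    refine h.tendsto_treeChar_const hm (c := fun q => c (q + p) * l j) ?_
    have := (tendsto_sq_mul_secondMoment hm hc p).const_mul (l j ^ 2)
    rw [one_mul] at this
    exact this.congr fun q => by ring

end

/-! ### Characterization of the Wiener measure by the dyadic increments -/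

/-- The point `j / 2 ^ p` of `[0,1]` (projected to `[0,1]` if `j > 2 ^ p`). -/
def gridPoint (p j : ℕ) : unitInterval :=
  Set.projIcc 0 1 zero_le_one ((j : ℝ) / 2 ^ p)

/-- The increment of a path over the `j`-th dyadic interval of level `p`. -/
def gridIncr (p j : ℕ) (f : C(unitInterval, ℝ)) : ℝ :=
  f (gridPoint p (j + 1)) - f (gridPoint p j)

/-- A linear combination of the initial value and of the dyadic increments of level `p`. -/
def gridSum (p : ℕ) (a : ℝ) (l : ℕ → ℝ) (f : C(unitInterval, ℝ)) : ℝ :=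
  a * f 0 + ∑ j ∈ Finset.range (2 ^ p), l j * gridIncr p j f

/-- The joint characteristic functions of the initial value and of the dyadic increments are those
of the Brownian motion. -/
def HasBrownianGrid (W : Measure C(unitInterval, ℝ)) : Prop :=
  ∀ (p : ℕ) (a : ℝ) (l : ℕ → ℝ), ∫ f, Complex.exp (gridSum p a l f * Complex.I) ∂W =
    (Real.exp (-(∑ j ∈ Finset.range (2 ^ p), l j ^ 2 * (1 / 2) ^ p) / 2) : ℝ)

theorem continuous_gridSum (p : ℕ) (a : ℝ) (l : ℕ → ℝ) : Continuous (gridSum p a l) := by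
  unfold gridSum gridIncr
  have h : ∀ t : unitInterval, Continuous fun f : C(unitInterval, ℝ) => f t :=
    fun t => continuous_eval_const t
  fun_prop

theorem gridPoint_zero (p : ℕ) : gridPoint p 0 = 0 := by
  simp [gridPoint, Set.projIcc_left]

theorem coe_gridPoint {p j : ℕ} (h : j ≤ 2 ^ p) : (gridPoint p j : ℝ) = j / 2 ^ p := by
  rw [gridPoint, Set.projIcc_of_mem zero_le_one (x := (j : ℝ) / 2 ^ p)]
  exact ⟨by positivity, div_le_one_of_le₀ (by exact_mod_cast h) (by positivity)⟩

theorem apply_gridPoint {p K : ℕ} (hK : K ≤ 2 ^ p) (f : C(unitInterval, ℝ)) :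
    f (gridPoint p K) = f 0 +
      ∑ j ∈ Finset.range (2 ^ p), (if j < K then 1 else 0) * gridIncr p j f := by
  have h1 : ∑ j ∈ Finset.range (2 ^ p), (if j < K then 1 else 0) * gridIncr p j f =
      ∑ j ∈ Finset.range K, gridIncr p j f := by
    simp only [ite_mul, one_mul, zero_mul]
    rw [← Finset.sum_filter]
    congr 1
    ext j
    simp only [Finset.mem_filter, Finset.mem_range]
    omega
  have h2 : ∑ j ∈ Finset.range K, gridIncr p j f = f (gridPoint p K) - f (gridPoint p 0) :=
    Finset.sum_range_sub (fun j => f (gridPoint p j)) K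
  rw [h1, h2, gridPoint_zero]
  ring

theorem sum_mul_apply_gridPoint {ι : Type*} [Fintype ι] {p : ℕ} (a : ι → ℝ) {K : ι → ℕ}
    (hK : ∀ k, K k ≤ 2 ^ p) (f : C(unitInterval, ℝ)) :
    ∑ k, a k * f (gridPoint p (K k)) =
      gridSum p (∑ k, a k) (fun j => ∑ k, a k * if j < K k then 1 else 0) f := by
  simp_rw [apply_gridPoint (hK _), gridSum, mul_add, Finset.sum_add_distrib, Finset.sum_mul,
    Finset.mul_sum]
  rw [Finset.sum_comm (s := Finset.range (2 ^ p))]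
  simp only [mul_assoc]

theorem sum_sq_indicator {ι : Type*} [Fintype ι] {N : ℕ} (a : ι → ℝ) {K : ι → ℕ}
    (hK : ∀ k, K k ≤ N) :
    ∑ j ∈ Finset.range N, (∑ k, a k * if j < K k then (1 : ℝ) else 0) ^ 2 =
      ∑ k, ∑ l, a k * a l * min (K k : ℝ) (K l) := by
  simp_rw [sq, Finset.sum_mul_sum]
  rw [Finset.sum_comm]
  refine Finset.sum_congr rfl fun k _ => ?_
  rw [Finset.sum_comm]
  refine Finset.sum_congr rfl fun l _ => ?_
  have h1 : ∀ j, (a k * if j < K k then (1 : ℝ) else 0) * (a l * if j < K l then (1 : ℝ) else 0) =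
      a k * a l * if j < min (K k) (K l) then 1 else 0 := by
    intro j
    by_cases h1 : j < K k <;> by_cases h2 : j < K l <;> simp [h1, h2]
  simp_rw [h1]
  rw [← Finset.mul_sum, ← Finset.sum_filter, Finset.sum_const, nsmul_eq_mul, mul_one]
  have h2 : Finset.filter (fun j => j < min (K k) (K l)) (Finset.range N) =
      Finset.range (min (K k) (K l)) := by
    ext j
    have := hK k
    simp only [Finset.mem_filter, Finset.mem_range]
    omega
  rw [h2, Finset.card_range, Nat.cast_min]

theorem floor_two_pow_mul_le (p : ℕ) (t : unitInterval) : ⌊2 ^ p * (t : ℝ)⌋₊ ≤ 2 ^ p := by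
  refine Nat.floor_le_of_le ?_
  push_cast
  exact mul_le_of_le_one_right (by positivity) t.2.2

theorem tendsto_floor_div (t : unitInterval) :
    Tendsto (fun p : ℕ => (⌊2 ^ p * (t : ℝ)⌋₊ : ℝ) / 2 ^ p) atTop (𝓝 t) := by
  have h := (tendsto_nat_floor_mul_div_atTop (R := ℝ) t.2.1).comp
    (tendsto_pow_atTop_atTop_of_one_lt (r := (2 : ℝ)) (by norm_num))
  refine h.congr fun p => ?_
  simp only [Function.comp_apply]
  rw [mul_comm]

theorem tendsto_gridPoint_floor (t : unitInterval) :
    Tendsto (fun p : ℕ => gridPoint p ⌊2 ^ p * (t : ℝ)⌋₊) atTop (𝓝 t) := by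
  have h := (continuous_projIcc (h := zero_le_one (α := ℝ))).continuousAt.tendsto.comp
    (tendsto_floor_div t)
  rwa [Set.projIcc_val] at h

theorem tendsto_integral_exp_mul_I {α : Type*} [MeasurableSpace α] (W : Measure α)
    [IsProbabilityMeasure W] {g : ℕ → α → ℝ} {G : α → ℝ} (hg : ∀ n, Measurable (g n))
    (hlim : ∀ x, Tendsto (fun n => g n x) atTop (𝓝 (G x))) :
    Tendsto (fun n => ∫ x, Complex.exp (g n x * Complex.I) ∂W) atTop
      (𝓝 (∫ x, Complex.exp (G x * Complex.I) ∂W)) := by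
  refine tendsto_integral_of_dominated_convergence (fun _ => 1) (fun n => ?_)
    (integrable_const _) (fun n => Eventually.of_forall fun x => ?_)
    (Eventually.of_forall fun x => ?_)
  · have := hg n
    fun_prop
  · exact (Complex.norm_exp_ofReal_mul_I _).le
  · exact (Complex.continuous_exp.tendsto _).comp
      (((Complex.continuous_ofReal.tendsto _).comp (hlim x)).mul_const _)

theorem measurable_apply (t : unitInterval) :
    Measurable fun f : C(unitInterval, ℝ) => f t :=
  (continuous_eval_const t).measurable

section

variable {W : Measure C(unitInterval, ℝ)} [IsProbabilityMeasure W]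

/-- Arbitrary times are approximated by their dyadic floors; path continuity and dominated
convergence pass to the limit, and the sums of squares of indicators yield the covariance `min s t`.
-/
theorem HasBrownianGrid.integral_exp (hW : HasBrownianGrid W) {ι : Type*} [Fintype ι]
    (a : ι → ℝ) (t : ι → unitInterval) :
    ∫ f : C(unitInterval, ℝ), Complex.exp ((∑ k, a k * f (t k) : ℝ) * Complex.I) ∂W =
      (Real.exp (-(∑ k, ∑ l, a k * a l * min (t k : ℝ) (t l)) / 2) : ℝ) := by
  have hlim := tendsto_integral_exp_mul_I W
    (g := fun p (f : C(unitInterval, ℝ)) =>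
      ∑ k, a k * f (gridPoint p ⌊2 ^ p * (t k : ℝ)⌋₊))
    (G := fun f => ∑ k, a k * f (t k))
    (fun p => Finset.measurable_sum _ fun k _ => (measurable_apply _).const_mul _)
    (fun f => tendsto_finsetSum _ fun k _ =>
      ((f.continuous.tendsto _).comp (tendsto_gridPoint_floor (t k))).const_mul _)
  refine tendsto_nhds_unique hlim ?_
  have hval : ∀ p : ℕ, ∫ f : C(unitInterval, ℝ), Complex.exp
      ((∑ k, a k * f (gridPoint p ⌊2 ^ p * (t k : ℝ)⌋₊) : ℝ) * Complex.I) ∂W =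
      (Real.exp (-(∑ k, ∑ l, a k * a l *
        min ((⌊2 ^ p * (t k : ℝ)⌋₊ : ℝ) / 2 ^ p) (⌊2 ^ p * (t l : ℝ)⌋₊ / 2 ^ p)) / 2) : ℝ) := by
    intro p
    simp_rw [sum_mul_apply_gridPoint a fun k => floor_two_pow_mul_le p (t k)]
    rw [hW, ← Finset.sum_mul, sum_sq_indicator a fun k => floor_two_pow_mul_le p (t k)]
    congr 4
    rw [Finset.sum_mul]
    refine Finset.sum_congr rfl fun k _ => ?_
    rw [Finset.sum_mul]
    refine Finset.sum_congr rfl fun l _ => ?_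
    rw [min_div_div_right (by positivity)]
    simp only [one_div, inv_pow]
    ring
  simp_rw [hval]
  refine (Complex.continuous_ofReal.tendsto _).comp ((Real.continuous_exp.tendsto _).comp ?_)
  refine Tendsto.div_const (Tendsto.neg ?_) 2
  exact tendsto_finsetSum _ fun k _ => tendsto_finsetSum _ fun l _ =>
    ((tendsto_floor_div (t k)).min (tendsto_floor_div (t l))).const_mul _

theorem HasBrownianGrid.integral_exp_sub (hW : HasBrownianGrid W) {ι : Type*} [Fintype ι]
    (a : ι → ℝ) (s t : ι → unitInterval) :
    ∫ f : C(unitInterval, ℝ), Complex.exp ((∑ k, a k * (f (t k) - f (s k)) : ℝ) * Complex.I) ∂W =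
      (Real.exp (-(∑ k, ∑ l, a k * a l * (min (t k : ℝ) (t l) - min (t k : ℝ) (s l) -
        min (s k : ℝ) (t l) + min (s k : ℝ) (s l))) / 2) : ℝ) := by
  -- Increments are combinations of values over two copies of `ι`, with weights `a` and `-a`.
  have h := hW.integral_exp (Sum.elim a fun k => -a k) (Sum.elim t s)
  simp only [Fintype.sum_sum_type, Sum.elim_inl, Sum.elim_inr] at h
  convert h using 6
  · rw [← Finset.sum_add_distrib]
    exact Finset.sum_congr rfl fun k _ => by ring
  · rw [← Finset.sum_add_distrib]
    refine Finset.sum_congr rfl fun k _ => ?_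
    rw [← Finset.sum_add_distrib, ← Finset.sum_add_distrib, ← Finset.sum_add_distrib]
    exact Finset.sum_congr rfl fun l _ => by ring

/-- A measure on `C([0,1])` is determined by its dyadic increments. -/
theorem HasBrownianGrid.unique (hW : HasBrownianGrid W) {W' : Measure C(unitInterval, ℝ)}
    [IsProbabilityMeasure W'] (hW' : HasBrownianGrid W') : W = W' := by
  refine Measure.ext_of_charFunDual ?_
  ext L
  -- Bernstein polynomials make any continuous functional `L` a pointwise limit of finite
  -- combinations of evaluations, so finite-dimensional laws determine the characteristic
  -- functional.
  have key : ∀ n : ℕ, ∀ f : C(unitInterval, ℝ), L (bernsteinApproximation n f) =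
      ∑ k : Fin (n + 1), L (bernstein n k) * f (bernstein.z k) := by
    intro n f
    rw [bernsteinApproximation, map_sum]
    refine Finset.sum_congr rfl fun k _ => ?_
    rw [mul_comm, ← smul_eq_mul, ← map_smul]
    congr 1
    ext x
    simp [mul_comm]
  have hlim : ∀ V : Measure C(unitInterval, ℝ), IsProbabilityMeasure V →
      Tendsto (fun n => ∫ f, Complex.exp ((∑ k : Fin (n + 1), L (bernstein n k) *
        f (bernstein.z k) : ℝ) * Complex.I) ∂V) atTop (𝓝 (charFunDual V L)) := by
    intro V hV
    rw [charFunDual_apply]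
    refine tendsto_integral_exp_mul_I V
      (g := fun n (f : C(unitInterval, ℝ)) =>
        ∑ k : Fin (n + 1), L (bernstein n k) * f (bernstein.z k))
      (fun n => Finset.measurable_sum _ fun k _ => (measurable_apply _).const_mul _) fun f => ?_
    simp_rw [← key]
    exact (L.continuous.tendsto _).comp (bernsteinApproximation_uniform f)
  refine tendsto_nhds_unique (hlim W inferInstance) ((hlim W' inferInstance).congr fun n => ?_)
  rw [hW.integral_exp, hW'.integral_exp]

theorem HasBrownianGrid.hasLaw_sub (hW : HasBrownianGrid W) {s t : unitInterval} (hst : s ≤ t) :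
    HasLaw (fun f : C(unitInterval, ℝ) => f t - f s) (gaussianReal 0 (Real.toNNReal (t - s))) W := by
  have hmeas : Measurable fun f : C(unitInterval, ℝ) => f t - f s :=
    (measurable_apply t).sub (measurable_apply s)
  refine ⟨hmeas.aemeasurable, ?_⟩
  have := Measure.isProbabilityMeasure_map (μ := W) hmeas.aemeasurable
  refine Measure.ext_of_charFun ?_
  ext u
  rw [charFun_gaussianReal, charFun_apply_real, integral_map hmeas.aemeasurable (by fun_prop)]
  have h := hW.integral_exp_sub (ι := Unit) (fun _ => u) (fun _ => s) (fun _ => t)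
  simp only [Finset.univ_unique, Finset.sum_singleton] at h
  have hst' : (s : ℝ) ≤ t := hst
  simp only [Complex.ofReal_mul] at h
  rw [h, Complex.ofReal_exp, min_self, min_self, min_eq_right hst', min_eq_left hst',
    Real.coe_toNNReal _ (sub_nonneg.2 hst')]
  congr 1
  push_cast
  ring

theorem HasBrownianGrid.hasIndepIncrements (hW : HasBrownianGrid W) :
    HasIndepIncrements (fun (t : unitInterval) (f : C(unitInterval, ℝ)) => f t) W := by
  intro n t ht
  have hmeas : ∀ i : Fin n, Measurable fun f : C(unitInterval, ℝ) =>
      f (t i.succ) - f (t i.castSucc) := fun i => (measurable_apply _).sub (measurable_apply _)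
  rw [iIndepFun_iff_charFunDual_pi fun i => (hmeas i).aemeasurable]
  intro L
  set a : Fin n → ℝ := fun i => L (Pi.single i 1) with ha
  have hL : ∀ v : Fin n → ℝ, L v = ∑ i, a i * v i := fun v => by
    conv_lhs => rw [← Finset.univ_sum_single v, map_sum L]
    refine Finset.sum_congr rfl fun i _ => ?_
    rw [ha, mul_comm, ← smul_eq_mul, ← map_smul, ← Pi.single_smul]
    simp
  have hLs : ∀ (i : Fin n) (x : ℝ), (L.comp (.single ℝ (fun _ => ℝ) i)) x = a i * x := by
    intro i x
    rw [ContinuousLinearMap.comp_apply, ha, mul_comm, ← smul_eq_mul, ← map_smul, ← Pi.single_smul]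
    simp
  simp_rw [charFunDual_apply]
  rw [integral_map (measurable_pi_lambda _ hmeas).aemeasurable (by fun_prop)]
  simp_rw [hL]
  rw [hW.integral_exp_sub a (fun i => t i.castSucc) (fun i => t i.succ)]
  have hone : ∀ i : Fin n, ∫ v, Complex.exp (((L.comp (.single ℝ (fun _ => ℝ) i)) v : ℝ) *
      Complex.I) ∂(W.map fun f : C(unitInterval, ℝ) => f (t i.succ) - f (t i.castSucc)) =
      (Real.exp (-(a i ^ 2 * ((t i.succ : ℝ) - t i.castSucc)) / 2) : ℝ) := by
    intro i
    simp_rw [hLs]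
    rw [integral_map (hmeas i).aemeasurable (by fun_prop)]
    have h := hW.integral_exp_sub (ι := Unit) (fun _ => a i) (fun _ => t i.castSucc)
      (fun _ => t i.succ)
    simp only [Finset.univ_unique, Finset.sum_singleton] at h
    have hst : (t i.castSucc : ℝ) ≤ t i.succ := ht (Fin.castSucc_le_succ i)
    rw [h, min_self, min_self, min_eq_right hst, min_eq_left hst]
    congr 4
    ring
  rw [Finset.prod_congr rfl fun i _ => hone i, ← Complex.ofReal_prod, ← Real.exp_sum,
    ← Finset.sum_div, Finset.sum_neg_distrib]
  refine congrArg (fun x : ℝ => ((Real.exp (-x / 2) : ℝ) : ℂ)) (Finset.sum_congr rfl fun i _ => ?_)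
  -- Off the diagonal the intervals do not overlap, so the four minima cancel.
  rw [Finset.sum_eq_single i]
  · have hst : (t i.castSucc : ℝ) ≤ t i.succ := ht (Fin.castSucc_le_succ i)
    rw [min_self, min_self, min_eq_right hst, min_eq_left hst]
    ring
  · intro j _ hji
    have hi : (t i.castSucc : ℝ) ≤ t i.succ := ht (Fin.castSucc_le_succ i)
    have hj : (t j.castSucc : ℝ) ≤ t j.succ := ht (Fin.castSucc_le_succ j)
    rcases lt_or_gt_of_ne hji with h | h
    · have hm : (t j.succ : ℝ) ≤ t i.castSucc := ht (Fin.le_def.2 (by simpa using h))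
      rw [min_eq_right (by linarith), min_eq_right (by linarith), min_eq_right (by linarith),
        min_eq_right (by linarith)]
      ring
    · have hm : (t i.succ : ℝ) ≤ t j.castSucc := ht (Fin.le_def.2 (by simpa using h))
      rw [min_eq_left (by linarith), min_eq_left (by linarith), min_eq_left (by linarith),
        min_eq_left (by linarith)]
      ring
  · simp

theorem HasBrownianGrid.isWienerMeasure (hW : HasBrownianGrid W) : IsWienerMeasure W where
  start_zero := by
    have hm := measurable_apply 0
    have := Measure.isProbabilityMeasure_map (μ := W) hm.aemeasurable
    have h : W.map (fun f : C(unitInterval, ℝ) => f 0) = gaussianReal 0 0 := by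
      refine Measure.ext_of_charFun ?_
      ext u
      rw [charFun_gaussianReal, charFun_apply_real, integral_map hm.aemeasurable (by fun_prop)]
      have h := hW.integral_exp (ι := Unit) (fun _ => u) (fun _ => 0)
      simp only [Finset.univ_unique, Finset.sum_singleton, Complex.ofReal_mul] at h
      rw [h]
      simp
    rw [gaussianReal_zero_var] at h
    exact (HasLaw.mk hm.aemeasurable h).ae_eq_of_dirac
  indep_increments := hW.hasIndepIncrements
  gaussian_increments _ _ hst := hW.hasLaw_sub hst

end

/-- Weak convergence to the Wiener measure follows from tightness and from the convergence of the
characteristic functions of the dyadic increments. -/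
theorem exists_isWienerMeasure_tendsto {μ : ℕ → ProbabilityMeasure C(unitInterval, ℝ)}
    (htight : IsTightMeasureSet {((ν : ProbabilityMeasure C(unitInterval, ℝ)) :
      Measure C(unitInterval, ℝ)) | ν ∈ Set.range μ})
    (hchar : ∀ (p : ℕ) (a : ℝ) (l : ℕ → ℝ),
      Tendsto (fun n => ∫ f, Complex.exp (gridSum p a l f * Complex.I)
        ∂(μ n : Measure C(unitInterval, ℝ))) atTop
        (𝓝 (Real.exp (-(∑ j ∈ Finset.range (2 ^ p), l j ^ 2 * (1 / 2) ^ p) / 2) : ℝ))) :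
    ∃ W : ProbabilityMeasure C(unitInterval, ℝ),
      IsWienerMeasure (W : Measure C(unitInterval, ℝ)) ∧ Tendsto μ atTop (𝓝 W) := by
  have hcomp := isCompact_closure_of_isTightMeasureSet htight
  -- Ultrafilters replace subsequences: compactness gives a limit along each of them, and uniqueness
  -- of the law makes these limits coincide.
  have hlim : ∀ U : Ultrafilter ℕ, (U : Filter ℕ) ≤ atTop →
      ∃ W : ProbabilityMeasure C(unitInterval, ℝ),
        HasBrownianGrid (W : Measure C(unitInterval, ℝ)) ∧ Tendsto μ U (𝓝 W) := by
    intro U hU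
    obtain ⟨W, -, hW⟩ := hcomp.ultrafilter_le_nhds (U.map μ)
      (le_principal_iff.2 (mem_map.2 (Eventually.of_forall fun n => subset_closure ⟨n, rfl⟩)))
    have hW' : Tendsto μ U (𝓝 W) := hW
    refine ⟨W, fun p a l => ?_, hW'⟩
    have hcont : Continuous fun f : C(unitInterval, ℝ) =>
        Complex.exp (gridSum p a l f * Complex.I) := by
      have := continuous_gridSum p a l
      fun_prop
    have h := (ProbabilityMeasure.tendsto_iff_forall_integral_rclike_tendsto ℂ).1 hW'
      (BoundedContinuousFunction.ofNormedAddCommGroup _ hcont 1 fun f =>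
        (Complex.norm_exp_ofReal_mul_I _).le)
    exact tendsto_nhds_unique h ((hchar p a l).mono_left hU)
  obtain ⟨W, hW, -⟩ := hlim (Ultrafilter.of atTop) (Ultrafilter.of_le _)
  refine ⟨W, hW.isWienerMeasure, (tendsto_iff_ultrafilter _ _ _).2 fun U hU => ?_⟩
  obtain ⟨W', hW', hlim'⟩ := hlim U hU
  have h : (W' : Measure C(unitInterval, ℝ)) = W := hW'.unique hW
  rwa [Subtype.ext h] at hlim'

/-! ### Tightness from fourth moments of the dyadic increments -/

/-- The paths starting from `0` whose dyadic increments of level `p` are at most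
`M * (9 / 10) ^ p`. -/
def holderPaths (M : ℝ) : Set C(unitInterval, ℝ) :=
  {f | f 0 = 0 ∧ ∀ p, ∀ j < 2 ^ p, |gridIncr p j f| ≤ M * (9 / 10) ^ p}

theorem continuous_gridIncr (p j : ℕ) : Continuous (gridIncr p j) :=
  (continuous_eval_const _).sub (continuous_eval_const _)

theorem isClosed_holderPaths (M : ℝ) : IsClosed (holderPaths M) := by
  have h : holderPaths M = {f | f 0 = 0} ∩
      ⋂ (p : ℕ) (j : ℕ) (_ : j < 2 ^ p), {f | |gridIncr p j f| ≤ M * (9 / 10) ^ p} := by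
    ext f
    simp [holderPaths]
  rw [h]
  refine (isClosed_eq (continuous_eval_const 0) continuous_const).inter ?_
  exact isClosed_iInter fun p => isClosed_iInter fun j => isClosed_iInter fun _ =>
    isClosed_le (continuous_gridIncr p j).abs continuous_const

theorem gridPoint_succ_two_mul (p K : ℕ) : gridPoint (p + 1) (2 * K) = gridPoint p K := by
  rw [gridPoint, gridPoint]
  congr 1
  push_cast
  rw [pow_succ]
  field_simp

theorem floor_two_mul_eq {x : ℝ} (hx : 0 ≤ x) :
    ⌊2 * x⌋₊ = 2 * ⌊x⌋₊ ∨ ⌊2 * x⌋₊ = 2 * ⌊x⌋₊ + 1 := by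
  have h1 := Nat.floor_le hx
  have h2 := Nat.lt_floor_add_one x
  have h3 : 2 * ⌊x⌋₊ ≤ ⌊2 * x⌋₊ := Nat.le_floor (by push_cast; linarith)
  have h4 : ⌊2 * x⌋₊ < 2 * ⌊x⌋₊ + 2 := (Nat.floor_lt (by linarith)).2 (by push_cast; linarith)
  omega

section

variable {M : ℝ} {f : C(unitInterval, ℝ)}

theorem dist_gridPoint_floor_succ_le (hM : 0 ≤ M) (hf : f ∈ holderPaths M) (t : unitInterval)
    (p : ℕ) :
    dist (f (gridPoint p ⌊2 ^ p * (t : ℝ)⌋₊))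
      (f (gridPoint (p + 1) ⌊2 ^ (p + 1) * (t : ℝ)⌋₊)) ≤ M * (9 / 10) ^ p := by
  have ht : (0 : ℝ) ≤ 2 ^ p * t := mul_nonneg (by positivity) t.2.1
  have hle := floor_two_pow_mul_le (p + 1) t
  have e : (2 : ℝ) ^ (p + 1) * t = 2 * (2 ^ p * t) := by ring
  rw [e] at hle ⊢
  rcases floor_two_mul_eq ht with h | h
  · rw [h, gridPoint_succ_two_mul, dist_self]
    positivity
  · rw [h] at hle ⊢
    rw [← gridPoint_succ_two_mul, dist_comm, Real.dist_eq]
    refine (hf.2 (p + 1) _ (by omega)).trans ?_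
    rw [pow_succ]
    have : 0 ≤ M * (9 / 10) ^ p := by positivity
    linarith

/-- Chaining along the dyadic floors of `t`; the factor 10 is `1 / (1 - 9/10)`. -/
theorem dist_apply_gridPoint_floor_le (hM : 0 ≤ M) (hf : f ∈ holderPaths M) (t : unitInterval)
    (p : ℕ) : dist (f (gridPoint p ⌊2 ^ p * (t : ℝ)⌋₊)) (f t) ≤ 10 * M * (9 / 10) ^ p := by
  refine (dist_le_of_le_geometric_of_tendsto (9 / 10) M (by norm_num)
    (dist_gridPoint_floor_succ_le hM hf t)
    ((f.continuous.tendsto _).comp (tendsto_gridPoint_floor t)) p).trans (le_of_eq ?_)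
  ring

theorem dist_gridPoint_le (hM : 0 ≤ M) (hf : f ∈ holderPaths M) {p j k : ℕ} (hj : j ≤ 2 ^ p)
    (hk : k ≤ 2 ^ p) (hjk : j ≤ k + 1) (hkj : k ≤ j + 1) :
    dist (f (gridPoint p j)) (f (gridPoint p k)) ≤ M * (9 / 10) ^ p := by
  rcases (by omega : j = k ∨ j = k + 1 ∨ k = j + 1) with h | h | h
  · rw [h, dist_self]; positivity
  · rw [h, Real.dist_eq]; exact hf.2 p k (by omega)
  · rw [h, dist_comm, Real.dist_eq]; exact hf.2 p j (by omega)

theorem floor_le_floor_add_one {x y : ℝ} (hy : 0 ≤ y) (h : x ≤ y + 1) :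
    ⌊x⌋₊ ≤ ⌊y⌋₊ + 1 := by
  rw [← Nat.floor_add_one hy]
  exact Nat.floor_mono h

/-- Here `21 = 10 + 1 + 10`: each point is joined to its dyadic floor, and these two floors are
equal or adjacent. -/
theorem dist_apply_le (hM : 0 ≤ M) (hf : f ∈ holderPaths M) {s t : unitInterval} {p : ℕ}
    (hst : dist s t ≤ (1 / 2) ^ p) : dist (f s) (f t) ≤ 21 * M * (9 / 10) ^ p := by
  have h1 := dist_apply_gridPoint_floor_le hM hf s p
  have h2 := dist_apply_gridPoint_floor_le hM hf t p
  have h2p : (0 : ℝ) < 2 ^ p := by positivity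
  have h3 : |(2 : ℝ) ^ p * s - 2 ^ p * t| ≤ 1 := by
    rw [← mul_sub, abs_mul, abs_of_pos h2p]
    have : |(s : ℝ) - t| ≤ (1 / 2) ^ p := hst
    calc (2 : ℝ) ^ p * |(s : ℝ) - t| ≤ 2 ^ p * (1 / 2) ^ p := by gcongr
      _ = 1 := by rw [← mul_pow]; norm_num
  rw [abs_le] at h3
  have hs0 : (0 : ℝ) ≤ 2 ^ p * s := mul_nonneg h2p.le s.2.1
  have ht0 : (0 : ℝ) ≤ 2 ^ p * t := mul_nonneg h2p.le t.2.1
  have h4 := dist_gridPoint_le hM hf (floor_two_pow_mul_le p s) (floor_two_pow_mul_le p t)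
    (floor_le_floor_add_one ht0 (by linarith)) (floor_le_floor_add_one hs0 (by linarith))
  rw [dist_comm] at h1
  have := dist_triangle4 (f s) (f (gridPoint p ⌊2 ^ p * (s : ℝ)⌋₊))
    (f (gridPoint p ⌊2 ^ p * (t : ℝ)⌋₊)) (f t)
  linarith

end

theorem isCompact_holderPaths {M : ℝ} (hM : 0 ≤ M) : IsCompact (holderPaths M) := by
  let e := ContinuousMap.isometryEquivBoundedOfCompact unitInterval ℝ
  have hA : IsCompact (e.symm ⁻¹' holderPaths M) := by
    refine BoundedContinuousFunction.arzela_ascoli₂ (Metric.closedBall 0 (21 * M))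
      (isCompact_closedBall _ _) _ ((isClosed_holderPaths M).preimage e.symm.continuous) ?_ ?_
    · intro g t hg
      -- At level 0 the modulus of continuity covers all of `[0,1]`; with `f 0 = 0` it is a uniform
      -- bound.
      have h := dist_apply_le hM hg (s := t) (t := 0) (p := 0) (by
        rw [pow_zero, Subtype.dist_eq, Real.dist_eq, abs_le]
        have h1 := t.2.1
        have h2 := t.2.2
        constructor <;> simp <;> linarith)
      rw [hg.1] at h
      have e1 : e.symm g t = g t := rfl
      rw [e1] at h
      simpa using h
    · intro t
      rw [Metric.equicontinuousAt_iff_right]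
      intro η hη
      have hlim : Tendsto (fun p : ℕ => 21 * M * (9 / 10 : ℝ) ^ p) atTop (𝓝 0) := by
        simpa using (tendsto_pow_atTop_nhds_zero_of_lt_one (r := (9 / 10 : ℝ)) (by norm_num)
          (by norm_num)).const_mul (21 * M)
      obtain ⟨p, hp⟩ := (hlim.eventually_lt_const hη).exists
      filter_upwards [Metric.closedBall_mem_nhds t (ε := (1 / 2) ^ p) (by positivity)] with s hs g
      refine lt_of_le_of_lt ?_ hp
      exact dist_apply_le hM g.2 (by rw [dist_comm]; exact hs)
  have himg : holderPaths M = e.symm '' (e.symm ⁻¹' holderPaths M) :=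
    (Set.image_preimage_eq _ e.symm.surjective).symm
  rw [himg]
  exact hA.image e.symm.continuous

/-- Markov and a union bound over `2^p` intervals give a series of ratio `(1/2) / (9/10)^4 =
5000/6561`. The rate `9/10` works because its fourth power exceeds `1/2`; the geometric sum
`6561/1561` is below 5. -/
theorem measure_compl_holderPaths_le {μ : Measure C(unitInterval, ℝ)} {C M : ℝ} (hC : 0 ≤ C)
    (hM : 0 < M) (h0 : ∀ᵐ f ∂μ, f 0 = 0)
    (h4 : ∀ p, ∀ j < 2 ^ p, ∫⁻ f, ENNReal.ofReal (gridIncr p j f ^ 4) ∂μ ≤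
      ENNReal.ofReal (C * (1 / 4) ^ p)) :
    μ (holderPaths M)ᶜ ≤ ENNReal.ofReal (5 * C / M ^ 4) := by
  have hsub : (holderPaths M)ᶜ ⊆ {f | ¬ f 0 = 0} ∪ ⋃ p : ℕ, ⋃ j ∈ Finset.range (2 ^ p),
      {f | ENNReal.ofReal ((M * (9 / 10) ^ p) ^ 4) ≤ ENNReal.ofReal (gridIncr p j f ^ 4)} := by
    intro f hf
    simp only [holderPaths, Set.mem_compl_iff, Set.mem_ofPred_eq, not_and_or, not_forall,
      not_le] at hf
    rcases hf with hf | ⟨p, j, hj, hf⟩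
    · exact Or.inl hf
    · refine Or.inr (Set.mem_iUnion.2 ⟨p, Set.mem_iUnion₂.2 ⟨j, Finset.mem_range.2 hj, ?_⟩⟩)
      refine ENNReal.ofReal_le_ofReal ?_
      rw [show gridIncr p j f ^ 4 = |gridIncr p j f| ^ 4 from (Even.pow_abs (by decide) _).symm]
      exact pow_le_pow_left₀ (by positivity) hf.le 4
  have hone : ∀ p, ∀ j ∈ Finset.range (2 ^ p),
      μ {f | ENNReal.ofReal ((M * (9 / 10) ^ p) ^ 4) ≤ ENNReal.ofReal (gridIncr p j f ^ 4)} ≤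
        ENNReal.ofReal (C * (1 / 4) ^ p / (M * (9 / 10) ^ p) ^ 4) := by
    intro p j hj
    have hpos : 0 < (M * (9 / 10) ^ p) ^ 4 := by positivity
    rw [ENNReal.ofReal_div_of_pos hpos]
    refine (meas_ge_le_lintegral_div ?_ (by simpa using hpos) ENNReal.ofReal_ne_top).trans ?_
    · exact (ENNReal.measurable_ofReal.comp
        ((continuous_gridIncr p j).measurable.pow_const 4)).aemeasurable
    · gcongr
      exact h4 p j (Finset.mem_range.1 hj)
  have hlevel : ∀ p, μ (⋃ j ∈ Finset.range (2 ^ p),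
      {f | ENNReal.ofReal ((M * (9 / 10) ^ p) ^ 4) ≤ ENNReal.ofReal (gridIncr p j f ^ 4)}) ≤
        ENNReal.ofReal (C / M ^ 4 * (5000 / 6561) ^ p) := by
    intro p
    refine (measure_biUnion_finset_le _ _).trans ((Finset.sum_le_sum (hone p)).trans ?_)
    rw [Finset.sum_const, Finset.card_range, nsmul_eq_mul, ← ENNReal.ofReal_natCast,
      ← ENNReal.ofReal_mul (by positivity)]
    refine ENNReal.ofReal_le_ofReal (le_of_eq ?_)
    have e : (5000 / 6561 : ℝ) ^ p = 2 ^ p * (1 / 4) ^ p / ((9 / 10) ^ p) ^ 4 := by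
      rw [← pow_mul, mul_comm p 4, pow_mul, ← mul_pow, ← div_pow]
      norm_num
    rw [e]
    push_cast
    field_simp
  refine (measure_mono hsub).trans ((measure_union_le _ _).trans ?_)
  rw [show μ {f | ¬ f 0 = 0} = 0 from h0, zero_add]
  refine (measure_iUnion_le _).trans ((ENNReal.tsum_le_tsum hlevel).trans ?_)
  have hsum : Summable fun p : ℕ => C / M ^ 4 * (5000 / 6561 : ℝ) ^ p :=
    (summable_geometric_of_lt_one (by norm_num) (by norm_num)).mul_left _
  rw [← ENNReal.ofReal_tsum_of_nonneg (fun p => by positivity) hsum, tsum_mul_left,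
    tsum_geometric_of_lt_one (by norm_num) (by norm_num)]
  refine ENNReal.ofReal_le_ofReal ?_
  have : 0 ≤ C / M ^ 4 := by positivity
  rw [mul_div_assoc]
  nlinarith

theorem isTightMeasureSet_of_gridIncr {S : Set (Measure C(unitInterval, ℝ))} {C : ℝ} (hC : 0 ≤ C)
    (h0 : ∀ μ ∈ S, ∀ᵐ f ∂μ, f 0 = 0)
    (h4 : ∀ μ ∈ S, ∀ p, ∀ j < 2 ^ p, ∫⁻ f, ENNReal.ofReal (gridIncr p j f ^ 4) ∂μ ≤
      ENNReal.ofReal (C * (1 / 4) ^ p)) :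
    IsTightMeasureSet S := by
  rw [isTightMeasureSet_iff_exists_isCompact_measure_compl_le]
  intro η hη
  have hlim : Tendsto (fun M : ℝ => ENNReal.ofReal (5 * C / M ^ 4)) atTop (𝓝 0) := by
    rw [← ENNReal.ofReal_zero]
    exact (ENNReal.continuous_ofReal.tendsto 0).comp
      (tendsto_const_nhds.div_atTop (tendsto_pow_atTop (by norm_num)))
  obtain ⟨M, hM, hM0⟩ := ((hlim.eventually_lt_const hη).and (eventually_gt_atTop 0)).exists
  exact ⟨holderPaths M, isCompact_holderPaths hM0.le, fun μ hμ =>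
    (measure_compl_holderPaths_le hC hM0 (h0 μ hμ) (h4 μ hμ)).trans hM.le⟩

/-! ### The interpolated walk on the dyadic grid -/

theorem interp_zero (e : List Bool → ℝ) (n : ℕ) : interp e n 0 = 0 := by
  change interpFun e n ((0 : unitInterval) : ℝ) = 0
  simp [interpFun, walk]

theorem interp_gridPoint (e : List Bool → ℝ) (q : ℕ) {p K : ℕ} (hK : K ≤ 2 ^ p) :
    interp e (q + p) (gridPoint p K) = walk e (q + p) (K * 2 ^ q) := by
  change interpFun e (q + p) (gridPoint p K : ℝ) = _
  have h : (2 : ℝ) ^ (q + p) * (gridPoint p K : ℝ) = ((K * 2 ^ q : ℕ) : ℝ) := by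
    rw [coe_gridPoint hK, pow_add]
    push_cast
    field_simp
  rw [interpFun, h, Nat.floor_natCast, sub_self, zero_mul, add_zero]

theorem gridIncr_interp (e : List Bool → ℝ) (q : ℕ) {p j : ℕ} (hj : j < 2 ^ p) :
    gridIncr p j (interp e (q + p)) =
      stepSum e (q + p) fun k => if k / 2 ^ q = j then 1 else 0 := by
  rw [gridIncr, interp_gridPoint e q (show j + 1 ≤ 2 ^ p from hj), interp_gridPoint e q hj.le, walk, walk,
    ← Finset.sum_Ico_eq_sub _ (Nat.mul_le_mul_right _ (show j ≤ j + 1 by omega)), stepSum]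
  simp only [ite_mul, one_mul, zero_mul]
  rw [← Finset.sum_filter]
  congr 1
  ext k
  have hq : 0 < 2 ^ q := by positivity
  have hb : (j + 1) * 2 ^ q ≤ 2 ^ (q + p) := by
    rw [pow_add, mul_comm (2 ^ q)]
    exact Nat.mul_le_mul_right _ hj
  simp only [Finset.mem_Ico, Finset.mem_filter, Finset.mem_range]
  rw [Nat.div_eq_iff hq]
  rw [Nat.add_mul, one_mul] at *
  omega

theorem gridSum_smul_interp (e : List Bool → ℝ) (q p : ℕ) (a c : ℝ) (l : ℕ → ℝ) :
    gridSum p a l (c • interp e (q + p)) =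
      stepSum e (q + p) fun k => c * l (k / 2 ^ q) := by
  have h0 : (c • interp e (q + p)) 0 = 0 := by simp [interp_zero]
  have h1 : ∀ j ∈ Finset.range (2 ^ p), l j * gridIncr p j (c • interp e (q + p)) =
      ∑ k ∈ Finset.range (2 ^ (q + p)), (if k / 2 ^ q = j then c * l j else 0) *
        step e (q + p) k := by
    intro j hj
    have h2 : gridIncr p j (c • interp e (q + p)) = c * gridIncr p j (interp e (q + p)) := by
      simp [gridIncr, mul_sub]
    rw [h2, gridIncr_interp e q (Finset.mem_range.1 hj), stepSum, Finset.mul_sum, Finset.mul_sum]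
    refine Finset.sum_congr rfl fun k _ => ?_
    split_ifs <;> ring
  rw [gridSum, h0, mul_zero, zero_add, Finset.sum_congr rfl h1, Finset.sum_comm, stepSum]
  refine Finset.sum_congr rfl fun k hk => ?_
  rw [← Finset.sum_mul, Finset.sum_ite_eq, if_pos]
  rw [Finset.mem_range, Nat.div_lt_iff_lt_mul (by positivity), ← pow_add, add_comm p q]
  exact Finset.mem_range.1 hk

theorem abs_interp_sub_le {e : List Bool → ℝ} (he : ∀ w, |e w| = 1) (n : ℕ) {s t : unitInterval}
    (hst : s ≤ t) : |interp e n t - interp e n s| ≤ 2 ^ n * (t - s) := by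
  -- The walk with all signs equal to 1 is `2^n t`. Its summands are nondecreasing in `t`, hence it
  -- dominates the increments of every other walk.
  have hsum : ∀ t : unitInterval,
      ∑ k ∈ Finset.range (2 ^ n + 1), max 0 (min 1 ((2 : ℝ) ^ n * t - k)) = 2 ^ n * t := by
    intro t
    have h := interpFun_eq_sum (fun _ => 1) n t.2.1 t.2.2
    simpa [interpFun, walk, step, signProd] using h.symm
  have hst' : (s : ℝ) ≤ t := hst
  have hrhs : (2 : ℝ) ^ n * (t - s) = ∑ k ∈ Finset.range (2 ^ n + 1),
      (max 0 (min 1 ((2 : ℝ) ^ n * t - k)) - max 0 (min 1 ((2 : ℝ) ^ n * s - k))) := by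
    rw [Finset.sum_sub_distrib, hsum, hsum, mul_sub]
  change |interpFun e n t - interpFun e n s| ≤ _
  rw [interpFun_eq_sum e n t.2.1 t.2.2, interpFun_eq_sum e n s.2.1 s.2.2, hrhs,
    ← Finset.sum_sub_distrib]
  refine (Finset.abs_sum_le_sum_abs _ _).trans (Finset.sum_le_sum fun k _ => ?_)
  have h1 : |step e n k| = 1 := by
    rw [step, signProd, Finset.abs_prod, Finset.prod_eq_one fun i _ => he _]
  rw [← sub_mul, abs_mul, h1, mul_one, abs_of_nonneg]
  have : (2 : ℝ) ^ n * s ≤ 2 ^ n * t := by gcongr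
  exact sub_nonneg.2 (max_le_max le_rfl (min_le_min le_rfl (sub_le_sub_right this _)))

theorem abs_gridIncr_interp_le {e : List Bool → ℝ} (he : ∀ w, |e w| = 1) (n r : ℕ) {j : ℕ}
    (hj : j < 2 ^ (n + r)) : |gridIncr (n + r) j (interp e n)| ≤ (1 / 2) ^ r := by
  have h1 := coe_gridPoint hj.le
  have h2 := coe_gridPoint (p := n + r) (Nat.succ_le_of_lt hj)
  have h3 : gridPoint (n + r) j ≤ gridPoint (n + r) (j + 1) := by
    rw [← Subtype.coe_le_coe, h1, h2]
    gcongr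
    simp
  refine (abs_interp_sub_le he n h3).trans (le_of_eq ?_)
  rw [h1, h2, pow_add]
  push_cast
  rw [one_div, inv_pow]
  field_simp
  ring

theorem measurable_step {Ω : Type*} [MeasurableSpace Ω] {ε : List Bool → Ω → ℝ}
    (h : ∀ w, Measurable (ε w)) (n k : ℕ) : Measurable fun ω => step (fun w => ε w ω) n k := by
  unfold step signProd
  exact Finset.measurable_prod _ fun _ _ => h _

theorem measurable_interp {Ω : Type*} [MeasurableSpace Ω] {ε : List Bool → Ω → ℝ}
    (h : ∀ w, Measurable (ε w)) (n : ℕ) : Measurable fun ω => interp (fun w => ε w ω) n := by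
  -- The path is a finite combination of fixed continuous functions with measurable real
  -- coefficients, which gives Borel measurability for the uniform norm.
  have hrep : (fun ω => interp (fun w => ε w ω) n) = fun ω => ∑ k ∈ Finset.range (2 ^ n + 1),
      step (fun w => ε w ω) n k •
        (⟨fun t => max 0 (min 1 ((2 : ℝ) ^ n * t - k)), by fun_prop⟩ : C(unitInterval, ℝ)) := by
    funext ω
    ext t
    rw [ContinuousMap.sum_apply]
    refine (interpFun_eq_sum _ n t.2.1 t.2.2).trans (Finset.sum_congr rfl fun k _ => ?_)
    simp [mul_comm]
  rw [hrep]
  refine Finset.measurable_sum _ fun k _ => ?_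
  have hc : ∀ g : C(unitInterval, ℝ), Continuous fun x : ℝ => x • g := fun g => by fun_prop
  exact (hc _).measurable.comp (measurable_step h n k)

/-! ### Convergence to the Brownian motion -/

theorem two_pow_mul_secondMoment_le (m : ℝ) (q p : ℕ) :
    2 ^ p * secondMoment m q ≤ secondMoment m (q + p) := by
  induction p with
  | zero => simp
  | succ p ih =>
    have := two_mul_secondMoment_le m (q + p)
    rw [pow_succ, ← add_assoc]
    linarith

namespace IsSignFamily

variable {Ω : Type*} [MeasurableSpace Ω] {P : Measure Ω} {m : ℝ} {ε : List Bool → Ω → ℝ}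
  [IsProbabilityMeasure P]

/-- For `p ≤ n` the increment is a block sum, and `2^p s_q ≤ s_n` with `q = n - p` gives the decay
in `p`. Below the mesh of the walk, the slope bound is enough. -/
theorem lintegral_gridIncr_pow_four_le (h : IsSignFamily P m ε) (hm : m ^ 2 ≤ 1 / 2) {c B : ℝ}
    {n : ℕ} (hcB : c ^ 2 * secondMoment m n ≤ B) (p j : ℕ) (hj : j < 2 ^ p) :
    ∫⁻ ω, ENNReal.ofReal (gridIncr p j (c • interp (fun w => ε w ω) n) ^ 4) ∂P ≤
      ENNReal.ofReal (9 * B ^ 2 * (1 / 4) ^ p) := by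
  have hsmul : ∀ g : C(unitInterval, ℝ), gridIncr p j (c • g) ^ 4 = c ^ 4 * gridIncr p j g ^ 4 :=
    fun g => by simp only [gridIncr, ContinuousMap.smul_apply, smul_eq_mul]; ring
  have hs := secondMoment_pos m n
  have hB : 0 ≤ B := le_trans (by positivity) hcB
  simp_rw [hsmul]
  rcases le_total p n with hpn | hpn
  · obtain ⟨q, rfl⟩ : ∃ q, n = q + p := ⟨n - p, by omega⟩
    simp_rw [gridIncr_interp _ q hj]
    rw [← ofReal_integral_eq_lintegral_ofReal ((h.integrable_pow _ _ 4).const_mul _)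
      (Eventually.of_forall fun ω => by positivity), integral_const_mul]
    refine ENNReal.ofReal_le_ofReal ?_
    have h4 := h.integral_stepSum_block_pow_four_le hm q p hj
    have hq := two_pow_mul_secondMoment_le m q p
    have hq0 := secondMoment_pos m q
    calc c ^ 4 * ∫ ω, stepSum (fun w => ε w ω) (q + p)
          (fun k => if k / 2 ^ q = j then 1 else 0) ^ 4 ∂P
        ≤ c ^ 4 * (9 * secondMoment m q ^ 2) := by gcongr
      _ = 9 * (c ^ 2 * (2 ^ p * secondMoment m q)) ^ 2 * (1 / 4) ^ p := by
          have : ((2 : ℝ) ^ p) ^ 2 * (1 / 4) ^ p = 1 := by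
            rw [← pow_mul, mul_comm p 2, pow_mul, ← mul_pow]; norm_num
          linear_combination (-9 * c ^ 4 * secondMoment m q ^ 2) * this
      _ ≤ 9 * B ^ 2 * (1 / 4) ^ p := by
          have : c ^ 2 * (2 ^ p * secondMoment m q) ≤ B :=
            (mul_le_mul_of_nonneg_left hq (sq_nonneg c)).trans hcB
          gcongr
  · obtain ⟨r, rfl⟩ : ∃ r, p = n + r := ⟨p - n, by omega⟩
    have hpt : ∀ ω, ENNReal.ofReal (c ^ 4 * gridIncr (n + r) j (interp (fun w => ε w ω) n) ^ 4) ≤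
        ENNReal.ofReal (9 * B ^ 2 * (1 / 4) ^ (n + r)) := by
      intro ω
      refine ENNReal.ofReal_le_ofReal ?_
      have h1 := abs_gridIncr_interp_le (fun w => h.abs_eq_one w ω) n r hj
      set x := gridIncr (n + r) j (interp (fun w => ε w ω) n)
      have h2 : x ^ 4 ≤ ((1 / 2) ^ r) ^ 4 := by
        rw [show x ^ 4 = |x| ^ 4 from (Even.pow_abs (by decide) _).symm]
        gcongr
      have h3 : c ^ 2 * 2 ^ n ≤ B :=
        (mul_le_mul_of_nonneg_left (two_pow_le_secondMoment m n) (sq_nonneg c)).trans hcB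
      have h4 : ((2 : ℝ) ^ n) ^ 2 * (1 / 4) ^ n = 1 := by
        rw [← pow_mul, mul_comm n 2, pow_mul, ← mul_pow]; norm_num
      have h5 : (((1 : ℝ) / 2) ^ r) ^ 4 ≤ (1 / 4) ^ r := by
        rw [← pow_mul, mul_comm r 4, pow_mul]
        gcongr
        norm_num
      calc c ^ 4 * x ^ 4 ≤ c ^ 4 * (1 / 4) ^ r := by gcongr; exact h2.trans h5
        _ = (c ^ 2 * 2 ^ n) ^ 2 * (1 / 4) ^ (n + r) := by
            rw [pow_add]
            linear_combination (-c ^ 4 * (1 / 4) ^ r) * h4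
        _ ≤ B ^ 2 * (1 / 4) ^ (n + r) := by gcongr
        _ ≤ 9 * B ^ 2 * (1 / 4) ^ (n + r) := by
            have : 0 ≤ B ^ 2 * (1 / 4 : ℝ) ^ (n + r) := by positivity
            linarith
    refine (lintegral_mono hpt).trans ?_
    simp

theorem exists_isWienerMeasure_tendstoInDistribution (h : IsSignFamily P m ε)
    (hm : m ^ 2 ≤ 1 / 2) {c : ℕ → ℝ}
    (hc : Tendsto (fun n => c n ^ 2 * secondMoment m n) atTop (𝓝 1)) :
    ∃ W : ProbabilityMeasure C(unitInterval, ℝ),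
      IsWienerMeasure (W : Measure C(unitInterval, ℝ)) ∧
      TendstoInDistribution (fun (n : ℕ) (ω : Ω) => c n • interp (fun w => ε w ω) n)
        atTop (fun f : C(unitInterval, ℝ) => f) (fun _ => P)
        (W : Measure C(unitInterval, ℝ)) := by
  have hX : ∀ n, Measurable fun ω => c n • interp (fun w => ε w ω) n := fun n =>
    (continuous_const_smul (c n)).measurable.comp (measurable_interp h.measurable n)
  obtain ⟨B, hB⟩ := hc.bddAbove_range
  have hcB : ∀ n, c n ^ 2 * secondMoment m n ≤ B := fun n => hB ⟨n, rfl⟩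
  set μ : ℕ → ProbabilityMeasure C(unitInterval, ℝ) := fun n =>
    ⟨P.map fun ω => c n • interp (fun w => ε w ω) n,
      Measure.isProbabilityMeasure_map (hX n).aemeasurable⟩ with hμ
  have htight : IsTightMeasureSet {((ν : ProbabilityMeasure C(unitInterval, ℝ)) :
      Measure C(unitInterval, ℝ)) | ν ∈ Set.range μ} := by
    refine isTightMeasureSet_of_gridIncr (C := 9 * B ^ 2) (by positivity) ?_ ?_
    · rintro _ ⟨_, ⟨n, rfl⟩, rfl⟩
      change ∀ᵐ f : C(unitInterval, ℝ) ∂(P.map _), f 0 = 0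
      rw [ae_map_iff (hX n).aemeasurable
        (isClosed_eq (continuous_eval_const 0) continuous_const).measurableSet]
      exact Eventually.of_forall fun ω => by simp [interp_zero]
    · rintro _ ⟨_, ⟨n, rfl⟩, rfl⟩ p j hj
      change ∫⁻ f, _ ∂(P.map _) ≤ _
      have hg : Measurable fun f => ENNReal.ofReal (gridIncr p j f ^ 4) :=
        ENNReal.measurable_ofReal.comp ((continuous_gridIncr p j).measurable.pow_const 4)
      rw [lintegral_map hg (hX n)]
      exact h.lintegral_gridIncr_pow_four_le hm (hcB n) p j hj
  obtain ⟨W, hW, hlim⟩ := exists_isWienerMeasure_tendsto htight fun p a l => by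
    -- For `n = q + p` the grid of level `p` consists of nodes of the walk, so dyadic increments are
    -- exact block sums.
    rw [← tendsto_add_atTop_iff_nat p]
    refine (h.tendsto_treeChar_block hm hc p l).congr fun q => ?_
    change _ = ∫ f, _ ∂(P.map _)
    have hg := (continuous_gridSum p a l).measurable
    rw [integral_map (hX _).aemeasurable (by fun_prop)]
    simp_rw [gridSum_smul_interp]
    rw [h.integral_exp_stepSum]
  refine ⟨W, hW, ⟨fun n => (hX n).aemeasurable, aemeasurable_id, ?_⟩⟩
  refine hlim.trans (le_of_eq (congrArg 𝓝 ?_))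
  exact Subtype.ext Measure.map_id.symm

end IsSignFamily

/-! ### The normalizing constants -/

theorem secondMoment_eq (m : ℝ) (n : ℕ) : secondMoment m n =
    2 ^ n * (1 + 1 / 2 * ∑ j ∈ Finset.range n, (2 * m ^ 2) ^ (j + 1)) := by
  induction n with
  | zero => simp [secondMoment]
  | succ n ih =>
    have h : ((2 * m) ^ n) ^ 2 = 2 ^ n * (2 * m ^ 2) ^ n := by
      rw [← pow_mul, mul_comm n 2, pow_mul, ← mul_pow]; ring_nf
    rw [secondMoment, ih, h, Finset.sum_range_succ]
    ring

/-- The factor by which the interpolated walk is multiplied in `normalized`. -/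
def normalizer (H : EReal) (n : ℕ) : ℝ :=
  if H = ⊥ then (√(2 ^ n))⁻¹
  else if H.toReal < 1 / 2 then
    (sigma H.toReal * (2 : ℝ) ^ (n * (1 / 2 - H.toReal)))⁻¹ * (2 : ℝ) ^ (-(n * H.toReal))
  else (sigma H.toReal * √n)⁻¹ * (2 : ℝ) ^ (-(n * H.toReal))

theorem normalized_eq_smul (H : EReal) (e : List Bool → ℝ) (n : ℕ) :
    normalized H e n = normalizer H n • interp e n := by
  unfold normalized normalizer normalizedReal cascade
  split_ifs <;> simp [smul_smul]

theorem two_mul_sq_rpow (h : ℝ) : 2 * ((2 : ℝ) ^ (h - 1)) ^ 2 = 2 ^ (2 * h - 1) := by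
  rw [← Real.rpow_natCast, ← Real.rpow_mul (by norm_num)]
  nth_rewrite 1 [← Real.rpow_one 2]
  rw [← Real.rpow_add (by norm_num)]
  congr 1
  push_cast
  ring

/-- With `r = 2m² = 2^(2H-1) < 1`, the ratio `s_n / 2^n` increases to `1 + r / (2(1 - r))`, which is
`σ²`. -/
theorem tendsto_normalizer_of_lt {h : ℝ} (hh : h < 1 / 2) :
    Tendsto (fun n : ℕ => ((sigma h * (2 : ℝ) ^ (n * (1 / 2 - h)))⁻¹ * (2 : ℝ) ^ (-(n * h))) ^ 2 *
      secondMoment ((2 : ℝ) ^ (h - 1)) n) atTop (𝓝 1) := by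
  set r : ℝ := 2 ^ (2 * h - 1) with hr
  have hr0 : 0 < r := by positivity
  have hr1 : r < 1 := Real.rpow_lt_one_of_one_lt_of_neg (by norm_num) (by linarith)
  have hs2 : sigma h ^ 2 = 1 + 1 / 2 * (r * (1 - r)⁻¹) := by
    have h2 : (2 : ℝ) ^ (2 - 2 * h) = 2 / r := by
      rw [hr, eq_div_iff (by positivity), ← Real.rpow_add (by norm_num)]
      norm_num
    have h3 : 0 < 1 - r := by linarith
    have h4 : ((2 : ℝ) ^ (2 - 2 * h) - 2)⁻¹ = 1 / 2 * (r * (1 - r)⁻¹) := by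
      rw [h2, show 2 / r - 2 = 2 * (1 - r) / r by field_simp, inv_div]
      field_simp
    rw [sigma, if_pos hh, h4, Real.sq_sqrt (by positivity)]
  have hspos : 0 < sigma h ^ 2 := by
    rw [hs2]
    have : 0 < 1 - r := by linarith
    positivity
  have hlim : Tendsto (fun n : ℕ => (sigma h ^ 2)⁻¹ *
      (1 + 1 / 2 * (r * ∑ j ∈ Finset.range n, r ^ j))) atTop (𝓝 1) := by
    have h1 := ((((hasSum_geometric_of_lt_one hr0.le hr1).tendsto_sum_nat.const_mul r).const_mul
      (1 / 2)).const_add 1).const_mul (sigma h ^ 2)⁻¹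
    rwa [← hs2, inv_mul_cancel₀ hspos.ne'] at h1
  refine hlim.congr fun n => ?_
  rw [secondMoment_eq, two_mul_sq_rpow, ← hr]
  have h5 : ((2 : ℝ) ^ (n * (1 / 2 - h)))⁻¹ ^ 2 * ((2 : ℝ) ^ (-(n * h))) ^ 2 * 2 ^ n = 1 := by
    rw [← Real.rpow_neg (by norm_num), ← mul_pow, ← Real.rpow_add (by norm_num),
      ← Real.rpow_natCast (_ ^ _ : ℝ), ← Real.rpow_mul (by norm_num), ← Real.rpow_natCast 2 n,
      ← Real.rpow_add (by norm_num)]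
    convert Real.rpow_zero 2 using 2
    push_cast
    ring
  have h6 : ∑ j ∈ Finset.range n, r ^ (j + 1) = r * ∑ j ∈ Finset.range n, r ^ j := by
    rw [Finset.mul_sum]
    exact Finset.sum_congr rfl fun j _ => pow_succ' r j
  rw [h6, mul_inv, mul_pow, mul_pow, inv_pow]
  linear_combination (-((sigma h ^ 2)⁻¹ * (1 + 1 / 2 * (r * ∑ j ∈ Finset.range n, r ^ j)))) * h5

/-- Here `2m² = 1`, so `s_n = 2^n (1 + n/2)`: the linear growth explains both `√n` and `σ² = 1/2`.
-/
theorem tendsto_normalizer_half :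
    Tendsto (fun n : ℕ => ((sigma (1 / 2) * √n)⁻¹ * (2 : ℝ) ^ (-(n * (1 / 2 : ℝ)))) ^ 2 *
      secondMoment ((2 : ℝ) ^ ((1 / 2 : ℝ) - 1)) n) atTop (𝓝 1) := by
  have hlim : Tendsto (fun n : ℕ => 2 / (n : ℝ) + 1) atTop (𝓝 1) := by
    simpa using (tendsto_const_div_atTop_nhds_zero_nat (2 : ℝ)).add_const 1
  refine hlim.congr' ?_
  filter_upwards [eventually_gt_atTop 0] with n hn
  have hn' : (0 : ℝ) < n := by exact_mod_cast hn
  have h1 : ((2 : ℝ) ^ (-(n * (1 / 2 : ℝ)))) ^ 2 * 2 ^ n = 1 := by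
    rw [← Real.rpow_natCast (_ ^ _ : ℝ), ← Real.rpow_mul (by norm_num), ← Real.rpow_natCast 2 n,
      ← Real.rpow_add (by norm_num)]
    convert Real.rpow_zero 2 using 2
    push_cast
    ring
  have h2 : (sigma (1 / 2) * √n) ^ 2 = n / 2 := by
    rw [sigma, if_neg (lt_irrefl _), mul_pow, div_pow, Real.sq_sqrt (by norm_num),
      Real.sq_sqrt hn'.le]
    ring
  rw [secondMoment_eq, two_mul_sq_rpow, show (2 * (1 / 2 : ℝ) - 1) = 0 by norm_num,
    Real.rpow_zero, mul_pow, inv_pow, h2]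
  simp only [one_pow, Finset.sum_const, Finset.card_range, nsmul_eq_mul, mul_one]
  have h3 : ((n : ℝ) / 2)⁻¹ * (1 + 1 / 2 * n) = 2 / n + 1 := by field_simp
  linear_combination (-((n : ℝ) / 2)⁻¹ * (1 + 1 / 2 * n)) * h1 - h3

theorem tendsto_normalizer {H : EReal} (hH : H ≤ ((1 / 2 : ℝ) : EReal)) :
    Tendsto (fun n => normalizer H n ^ 2 * secondMoment (signMean H) n) atTop (𝓝 1) := by
  induction H with
  | bot =>
    refine tendsto_const_nhds.congr fun n => ?_
    have : (0 : ℝ) < 2 ^ n := by positivity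
    simp [normalizer, signMean, secondMoment_eq, Real.sq_sqrt this.le, this.ne']
  | top => exact absurd hH (by simp)
  | coe h =>
    have hh : h ≤ 1 / 2 := by exact_mod_cast hH
    rcases hh.lt_or_eq with hlt | rfl
    · refine (tendsto_normalizer_of_lt hlt).congr fun n => ?_
      rw [normalizer, signMean, if_neg (EReal.coe_ne_bot _), if_neg (EReal.coe_ne_bot _),
        EReal.toReal_coe, if_pos hlt]
    · refine tendsto_normalizer_half.congr fun n => ?_
      rw [normalizer, signMean, if_neg (EReal.coe_ne_bot _), if_neg (EReal.coe_ne_bot _),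
        EReal.toReal_coe, if_neg (lt_irrefl _)]

theorem sq_signMean_le {H : EReal} (hH : H ≤ ((1 / 2 : ℝ) : EReal)) : signMean H ^ 2 ≤ 1 / 2 := by
  induction H with
  | bot => simp [signMean]
  | top => exact absurd hH (by simp)
  | coe h =>
    have hh : h ≤ 1 / 2 := by exact_mod_cast hH
    have h1 := two_mul_sq_rpow h
    have h2 : (2 : ℝ) ^ (2 * h - 1) ≤ 1 :=
      Real.rpow_le_one_of_one_le_of_nonpos (by norm_num) (by linarith)
    simp only [signMean, EReal.coe_ne_bot, if_false, EReal.toReal_coe]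
    linarith

/-! ### The sign family of the statement -/

theorem ae_signLaw (H : EReal) : ∀ᵐ x ∂signLaw H, x = 1 ∨ x = -1 := by
  have hs : MeasurableSet {x : ℝ | x = 1 ∨ x = -1} :=
    (measurableSet_singleton 1).union (measurableSet_singleton (-1))
  refine ae_add_measure_iff.2 ⟨Measure.ae_smul_measure ?_ _, Measure.ae_smul_measure ?_ _⟩
  · exact (ae_dirac_iff hs).2 (Or.inl rfl)
  · exact (ae_dirac_iff hs).2 (Or.inr rfl)

theorem integral_signLaw {H : EReal} (hH : H ≤ ((1 / 2 : ℝ) : EReal)) :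
    ∫ x, x ∂signLaw H = signMean H := by
  have h1 : |signMean H| ≤ 1 := by
    rw [← sq_le_one_iff_abs_le_one]
    linarith [sq_signMean_le hH]
  rw [abs_le] at h1
  have hi : ∀ (a x : ℝ), Integrable (fun y : ℝ => y) (ENNReal.ofReal a • Measure.dirac x) :=
    fun a x => (integrable_dirac (by simp)).smul_measure ENNReal.ofReal_ne_top
  rw [signLaw, integral_add_measure (hi _ _) (hi _ _), integral_smul_measure,
    integral_smul_measure, integral_dirac, integral_dirac, ENNReal.toReal_ofReal (by linarith),
    ENNReal.toReal_ofReal (by linarith)]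
  simp only [smul_eq_mul]
  ring

/-- The law constrains the signs only almost surely; a measurable modification with values exactly
`1` and `-1` makes the pointwise identities above available. -/
theorem exists_isSignFamily {Ω : Type*} [MeasurableSpace Ω] {P : Measure Ω} {H : EReal}
    (hH : H ≤ ((1 / 2 : ℝ) : EReal)) {ε : List Bool → Ω → ℝ} (hε_indep : iIndepFun ε P)
    (hε_law : ∀ w : List Bool, HasLaw (ε w) (signLaw H) P) :
    ∃ ε' : List Bool → Ω → ℝ, IsSignFamily P (signMean H) ε' ∧ ∀ w, ε' w =ᵐ[P] ε w := by
  classical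
  set ε' : List Bool → Ω → ℝ := fun w ω =>
    if (hε_law w).aemeasurable.mk (ε w) ω = 1 then 1 else -1 with hε'
  have hae : ∀ w, ε' w =ᵐ[P] ε w := by
    intro w
    have hs : MeasurableSet {x : ℝ | x = 1 ∨ x = -1} :=
      (measurableSet_singleton 1).union (measurableSet_singleton (-1))
    have h1 := ae_signLaw H
    rw [← (hε_law w).map_eq, ae_map_iff (hε_law w).aemeasurable hs] at h1
    filter_upwards [h1, (hε_law w).aemeasurable.ae_eq_mk] with ω h2 h3
    rw [hε']
    simp only [← h3]
    rcases h2 with h2 | h2 <;> rw [h2] <;> norm_num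
  refine ⟨ε', ⟨fun w => ?_, hε_indep.congr fun w => (hae w).symm, fun w ω => ?_, fun w => ?_⟩, hae⟩
  · exact Measurable.ite ((hε_law w).aemeasurable.measurable_mk (measurableSet_singleton 1))
      measurable_const measurable_const
  · rw [hε']
    dsimp only
    split_ifs <;> simp
  · rw [integral_congr_ae (hae w), (hε_law w).integral_eq, integral_signLaw hH]

end SignedCascade

end

theorem theorem3 {Ω : Type*} [MeasurableSpace Ω] (P : Measure Ω) [IsProbabilityMeasure P]
    (H : EReal) (hH : H ≤ ((1 / 2 : ℝ) : EReal))
    (ε : List Bool → Ω → ℝ)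
    (hε_indep : iIndepFun ε P)
    (hε_law : ∀ w : List Bool, HasLaw (ε w) (SignedCascade.signLaw H) P) :
    ∃ W : ProbabilityMeasure C(unitInterval, ℝ),
      SignedCascade.IsWienerMeasure (W : Measure C(unitInterval, ℝ)) ∧
      TendstoInDistribution
        (fun (n : ℕ) (ω : Ω) => SignedCascade.normalized H (fun w => ε w ω) n)
        atTop (fun f : C(unitInterval, ℝ) => f) (fun _ => P)
        (W : Measure C(unitInterval, ℝ)) := by
  obtain ⟨ε', hε', hae⟩ := SignedCascade.exists_isSignFamily hH hε_indep hε_law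
  obtain ⟨W, hW, hlim⟩ := hε'.exists_isWienerMeasure_tendstoInDistribution
    (SignedCascade.sq_signMean_le hH) (SignedCascade.tendsto_normalizer hH)
  refine ⟨W, hW, hlim.congr (fun n => ?_) Filter.EventuallyEq.rfl⟩
  -- There are countably many words, so one null set serves for all of them.
  filter_upwards [ae_all_iff.2 hae] with ω hω
  simp only [SignedCascade.normalized_eq_smul, hω]
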